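/- **Setting.** Let $X_1,X_2,\dots$ be observations with values in a measurable space, defined on a measurable space $(\Omega,\mathcal F)$, and let $\mathcal F_n=\sigma(X_1,\dots,X_n)$. Let $\Theta$ be a metric space with its Borel $\sigma$-algebra (for example a subset of $\mathbb R^p$). Let $\psi_i(x\mid x_1,\dots,x_{i-1})$ and $f_{\theta,i}(x\mid x_1,\dots,x_{i-1})$, $\theta\in\Theta$, $i\ge1$, be measurable (jointly in all arguments, including $\theta$) conditional probability densities with respect to a $\sigma$-finite measure $\mu$, with $f_{\theta,i}=0$ exactly where $\psi_i=0$. Let $\mathsf P_\infty$ and $\mathsf P_{\nu,\theta}$ ($\nu\in\{0,1,2,\dots\}$, $\theta\in\Theta$) be probability measures under which, for every $n$, $(X_1,\dots,X_n)$ has the density $\prod_{i\le n}\psi_i(X_i\mid X_1,\dots,X_{i-1})$, respectively $\prod_{i\le \min(\nu,n)}\psi_i(X_i\mid X_1,\dots,X_{i-1})\prod_{\nu<i\le n}f_{\theta,i}(X_i\mid X_1,\dots,X_{i-1})$, with respect to $\mu^{\otimes n}$. Put $$\Delta Z_i(\theta)=\log\frac{f_{\theta,i}(X_i\mid X_1,\dots,X_{i-1})}{\psi_i(X_i\mid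 X_1,\dots,X_{i-1})},\qquad Z_n^k(\theta)=\sum_{i=k+1}^n\Delta Z_i(\theta).$$ Let $W$ be a probability measure on $\Theta$ that gives positive mass to every ball $\Gamma_\delta=\Gamma_\delta(\theta)=\{u\in\Theta:|u-\theta|<\delta\}$, $\theta\in\Theta$, $\delta>0$. The weighted Shiryaev–Roberts (WSR) procedure is $$T_a=\inf\{n\ge1:\log R_n^W\ge a\},\qquad R_n^W=\sum_{k=1}^n\int_\Theta\prod_{i=k}^n\frac{f_{\theta,i}(X_i\mid X_1,\dots,X_{i-1})}{\psi_i(X_i\mid X_1,\dots,X_{i-1})}\,dW(\theta),\qquad \inf\varnothing=\infty .$$ For a stopping time $\tau$ of $(\mathcal F_n)_{n\ge0}$ with values in $\{0,1,\dots\}\cup\{\infty\}$ let $\mathcal R^r_{\nu,\theta}(\tau)=\mathsf E_{\nu,\theta}[(\tau-\nu)^r\mid\tau>\nu]$ and $\mathsf{PFA}_\varrho(\tau)=\sum_{k\ge0}\varrho(1-\varrho)^k\,\mathsf P_\infty(\tau\le k)$. (If $\mathsf P_{\nu,\theta}(\tau>\nu)=0$, put $\mathcal R^r_{\nu,\theta}(\tau)=0$.)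 Let $0<\varrho_\alpha<1$ for $0<\alpha<1$, with $\varrho_\alpha\to0$ and $|\log\varrho_\alpha|/|\log\alpha|\to0$ as $\alpha\to0$, and let $\Delta(\alpha)$ be the set of stopping times $\tau$ with $\mathsf{PFA}_{\varrho_\alpha}(\tau)\le\alpha$. We write $b_\alpha\sim c_\alpha$ if $b_\alpha/c_\alpha\to1$ as $\alpha\to0$. **Theorem.** Let $I_\theta\in(0,\infty)$, $\theta\in\Theta$. Assume: 1. (independent increments) for all $k\ge0$ and $\theta\in\Theta$, the random functions $u\mapsto\Delta Z_i(u)$ on $\Theta$, $i=k+1,k+2,\dots$, are independent (not necessarily identically distributed) under $\mathsf P_{k,\theta}$; 2. (A1) for all $k\ge0$, $\theta\in\Theta$ and $\varepsilon>0$, $\ \lim_{N\to\infty}\mathsf P_{k,\theta}\bigl\{\tfrac1N\max_{1\le n\le N}Z^k_{k+n}(\theta)\ge(1+\varepsilon)I_\theta\bigr\}=0$; 3. (weak left-tail condition) for all $\nu\ge0$, $\theta\in\Theta$, $\varepsilon>0$ and $\ell\ge\nu$, $$\lim_{\delta\to0}\limsup_{n\to\infty}\mathsf P_{\nu,\theta}\Bigl\{\frac1{n\,W(\Gamma_\delta)}\int_{\Gamma_\delta}Z^\ell_{\ell+n}(u)\,dW(u)<I_\theta-\varepsilon\Bigr\}=0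 .$$ (An integral that does not exist is read as $0$ here.) Then $T_{a_\alpha}\in\Delta(\alpha)$ for all $0<\alpha<1$ if $a_\alpha=\log\frac{1-\varrho_\alpha}{\varrho_\alpha\alpha}$, and then $a_\alpha\sim|\log\alpha|$. Moreover, for every choice of thresholds $a_\alpha$ with $a_\alpha\sim|\log\alpha|$ and $\mathsf{PFA}_{\varrho_\alpha}(T_{a_\alpha})\le\alpha$ for all small $\alpha$, the WSR procedure $T_{a_\alpha}$ is asymptotically optimal in $\Delta(\alpha)$ with respect to all positive moments of the detection delay: (i) (pointwise) for all $r>0$, $\theta\in\Theta$ and $\nu\ge0$, as $\alpha\to0$, $$\inf_{\tau\in\Delta(\alpha)}\mathcal R^r_{\nu,\theta}(\tau)\ \sim\ \Bigl(\frac{|\log\alpha|}{I_\theta}\Bigr)^r\ \sim\ \mathcal R^r_{\nu,\theta}(T_{a_\alpha});$$ (ii) (minimax) if in addition the weak left-tail condition holds uniformly in $\ell\ge\nu$, that is, if for all $\nu\ge0$, $\theta\in\Theta$ and $\varepsilon>0$ $$\lim_{\delta\to0}\limsup_{n\to\infty}\sup_{\ell\ge\nu}\mathsf P_{\nu,\theta}\Bigl\{\frac1{n\,W(\Gamma_\delta)}\int_{\Gamma_\delta}Z^\ell_{\ell+n}(u)\,dW(u)<I_\theta-\varepsilon\Bigr\}=0,$$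 then for all $r>0$, all $\theta\in\Theta$ and all integers $k^*_\alpha\ge 0$ with $k^*_\alpha\to\infty$ and $\alpha\varrho_\alpha k^*_\alpha\to0$, as $\alpha\to0$, $$\inf_{\tau\in\Delta(\alpha)}\max_{0\le\nu\le k^*_\alpha}\mathcal R^r_{\nu,\theta}(\tau)\ \sim\ \Bigl(\frac{|\log\alpha|}{I_\theta}\Bigr)^r\ \sim\ \max_{0\le\nu\le k^*_\alpha}\mathcal R^r_{\nu,\theta}(T_{a_\alpha}).$$ -/

import Mathlib

open MeasureTheory ProbabilityTheory Filter Topology Set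
open scoped ENNReal NNReal

/-- A change-point model with values in `𝓧`, pre-change conditional densities `ψ` and post-change
conditional densities `f θ`, `θ ∈ Θ`.

Observations are numbered from `0`: `X i` is the `(i + 1)`-st observation `X_{i+1}`, and
`ψ i h x`, `f θ i h x` are the densities at `x` of `X_{i+1}` given that
`(X_1, …, X_i) = h`.  The change point `ν` is the number of pre-change observations. -/
structure ChangePointModel (Ω 𝓧 Θ : Type*) [MeasurableSpace Ω] [MeasurableSpace 𝓧]
    [MeasurableSpace Θ] where
  /-- the observations -/
  X : ℕ → Ω → 𝓧
  measurable_X : ∀ i, Measurable (X i)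
  /-- the dominating measure -/
  μ : Measure 𝓧
  sigmaFinite_μ : SigmaFinite μ
  /-- pre-change conditional densities -/
  ψ : (i : ℕ) → (Fin i → 𝓧) → 𝓧 → ℝ≥0
  /-- post-change conditional densities -/
  f : Θ → (i : ℕ) → (Fin i → 𝓧) → 𝓧 → ℝ≥0
  measurable_ψ : ∀ i, Measurable fun p : (Fin i → 𝓧) × 𝓧 => ψ i p.1 p.2
  measurable_f : ∀ i, Measurable fun p : Θ × (Fin i → 𝓧) × 𝓧 => f p.1 i p.2.1 p.2.2
  lintegral_ψ : ∀ i h, ∫⁻ x, (ψ i h x : ℝ≥0∞) ∂μ = 1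
  lintegral_f : ∀ θ i h, ∫⁻ x, (f θ i h x : ℝ≥0∞) ∂μ = 1
  /-- the distribution when there is no change -/
  Pinf : Measure Ω
  /-- the distribution when the change point is `ν` and the post-change parameter is `θ` -/
  P : ℕ → Θ → Measure Ω
  isProbabilityMeasure_Pinf : IsProbabilityMeasure Pinf
  isProbabilityMeasure_P : ∀ ν θ, IsProbabilityMeasure (P ν θ)
  /-- under `Pinf` the joint density of the first `n` observations is `∏ ψ` -/
  law_Pinf : ∀ n : ℕ, Pinf.map (fun ω (i : Fin n) => X i ω) =
    (Measure.pi fun _ : Fin n => μ).withDensity fun x =>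
      ∏ i : Fin n, (ψ i (fun j => x (Fin.castLE i.2.le j)) (x i) : ℝ≥0∞)
  /-- under `P ν θ` the first `ν` observations have conditional densities `ψ`, the later ones
  have conditional densities `f θ` -/
  law_P : ∀ (ν : ℕ) (θ : Θ) (n : ℕ), (P ν θ).map (fun ω (i : Fin n) => X i ω) =
    (Measure.pi fun _ : Fin n => μ).withDensity fun x =>
      ∏ i : Fin n, (if (i : ℕ) < ν
        then (ψ i (fun j => x (Fin.castLE i.2.le j)) (x i) : ℝ≥0∞)
        else (f θ i (fun j => x (Fin.castLE i.2.le j)) (x i) : ℝ≥0∞))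

namespace ChangePointModel

section Basic

variable {Ω 𝓧 Θ : Type*} [MeasurableSpace Ω] [MeasurableSpace 𝓧] [MeasurableSpace Θ]

/-- The pre-change and post-change conditional densities vanish at the same points, so that the
log-likelihood ratios are finite. -/
def CommonSupport (M : ChangePointModel Ω 𝓧 Θ) : Prop :=
  ∀ θ i h x, M.f θ i h x = 0 ↔ M.ψ i h x = 0

/-- The likelihood ratio `f_{θ,i+1}(X_{i+1} | X_1, …, X_i) / ψ_{i+1}(X_{i+1} | X_1, …, X_i)`. -/
noncomputable def ratio (M : ChangePointModel Ω 𝓧 Θ) (i : ℕ) (θ : Θ) (ω : Ω) : ℝ≥0 :=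
  M.f θ i (fun j => M.X j ω) (M.X i ω) / M.ψ i (fun j => M.X j ω) (M.X i ω)

/-- The increment `ΔZ_{i+1}(θ)` of the log-likelihood ratio. -/
noncomputable def llrIncr (M : ChangePointModel Ω 𝓧 Θ) (i : ℕ) (θ : Θ) (ω : Ω) : ℝ :=
  Real.log (M.ratio i θ ω)

/-- The log-likelihood ratio `Z_n^k(θ) = ∑_{j=k+1}^n ΔZ_j(θ)` between "change at `k` with
parameter `θ`" and "no change". -/
noncomputable def llr (M : ChangePointModel Ω 𝓧 Θ) (k n : ℕ) (θ : Θ) (ω : Ω) : ℝ :=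
  ∑ i ∈ Finset.Ico k n, M.llrIncr i θ ω

/-- The weighted likelihood ratio `Λ_n^k(W) = ∫ ∏_{i=k+1}^n (f_{θ,i} / ψ_i) dW(θ)`. -/
noncomputable def weightedLR (M : ChangePointModel Ω 𝓧 Θ) (W : Measure Θ) (k n : ℕ) (ω : Ω) :
    ℝ≥0∞ :=
  ∫⁻ θ, ∏ i ∈ Finset.Ico k n, (M.ratio i θ ω : ℝ≥0∞) ∂W

/-- The weighted Shiryaev--Roberts statistic
`R_n^W = ∑_{k=1}^n ∫ ∏_{i=k}^n (f_{θ,i} / ψ_i) dW(θ)`; the sum runs over the number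
`k - 1 ∈ {0, …, n - 1}` of pre-change observations. -/
noncomputable def wsrStat (M : ChangePointModel Ω 𝓧 Θ) (W : Measure Θ) (n : ℕ) (ω : Ω) : ℝ≥0∞ :=
  ∑ k ∈ Finset.range n, M.weightedLR W k n ω

/-- The weighted Shiryaev--Roberts procedure `T_a = inf {n ≥ 1 : log R_n^W ≥ a}`, with
`inf ∅ = ∞`. -/
noncomputable def wsrTime (M : ChangePointModel Ω 𝓧 Θ) (W : Measure Θ) (a : ℝ) (ω : Ω) : ℕ∞ :=
  ⨅ (n : ℕ) (_ : 1 ≤ n ∧ (a : EReal) ≤ ENNReal.log (M.wsrStat W n ω)), (n : ℕ∞)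

/-- The filtration `F_n = σ(X_1, …, X_n)`; `F_0` is trivial. -/
def obsFiltration (M : ChangePointModel Ω 𝓧 Θ) : Filtration ℕ (‹MeasurableSpace Ω›) where
  seq n := ⨆ i : Fin n, MeasurableSpace.comap (M.X i) inferInstance
  mono' _ _ h := iSup_le fun i => le_iSup
    (fun j => MeasurableSpace.comap (M.X (j : Fin _)) inferInstance) (Fin.castLE h i)
  le' _ := iSup_le fun i => (M.measurable_X i).comap_le

/-- The weighted probability of false alarm `∑_k ϱ (1 - ϱ)^k P_∞(τ ≤ k)` for the geometric
prior with parameter `ϱ`. -/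
noncomputable def pfa (M : ChangePointModel Ω 𝓧 Θ) (ϱ : ℝ) (τ : Ω → ℕ∞) : ℝ≥0∞ :=
  ∑' k : ℕ, ENNReal.ofReal (ϱ * (1 - ϱ) ^ k) * M.Pinf {ω | τ ω ≤ (k : ℕ∞)}

/-- The class `Δ(α, ϱ)` of stopping times whose weighted probability of false alarm is at
most `α`. -/
def bayesClass (M : ChangePointModel Ω 𝓧 Θ) (α ϱ : ℝ) : Set (Ω → ℕ∞) :=
  {τ | IsStoppingTime M.obsFiltration τ ∧ M.pfa ϱ τ ≤ ENNReal.ofReal α}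

/-- The conditional moment `E_{ν,θ}[(τ - ν)^r | τ > ν]` of the detection delay. -/
noncomputable def risk (M : ChangePointModel Ω 𝓧 Θ) (r : ℝ) (ν : ℕ) (θ : Θ) (τ : Ω → ℕ∞) :
    ℝ≥0∞ :=
  ∫⁻ ω, ((τ ω - (ν : ℕ∞) : ℕ∞) : ℝ≥0∞) ^ r ∂((M.P ν θ)[|{ω | (ν : ℕ∞) < τ ω}])

/-- The log-likelihood ratio has independent increments after the change: for all `k` and `θ`,
the random functions `ΔZ_{k+1}(·), ΔZ_{k+2}(·), …` on `Θ` are independent under `P k θ`. -/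
def IndepIncrements (M : ChangePointModel Ω 𝓧 Θ) : Prop :=
  ∀ k θ, iIndepFun (fun (i : ℕ) (ω : Ω) (u : Θ) => M.llrIncr (k + i) u ω) (M.P k θ)

/-- The right-tail condition: for all `k`, `θ` and `ε > 0`, the `P k θ`-probability that
`N⁻¹ max_{1 ≤ n ≤ N} Z_{k+n}^k(θ) ≥ (1 + ε) I_θ` tends to `0` as `N → ∞`. -/
def RightTail (M : ChangePointModel Ω 𝓧 Θ) (I : Θ → ℝ) : Prop :=
  ∀ k θ, ∀ ε > 0, Tendsto (fun N : ℕ => M.P k θ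
    {ω | ∃ n ∈ Finset.Icc 1 N, (1 + ε) * I θ ≤ M.llr k (k + n) θ ω / N}) atTop (𝓝 0)

end Basic

section Metric

variable {Ω 𝓧 Θ : Type*} [MeasurableSpace Ω] [MeasurableSpace 𝓧] [MetricSpace Θ]
  [MeasurableSpace Θ]

/-- The event that the `W`-average of `n⁻¹ Z_{ℓ+n}^ℓ` over the ball `Γ_δ` of radius `δ` about
`θ` is smaller than `c`. -/
def lowEvent (M : ChangePointModel Ω 𝓧 Θ) (W : Measure Θ) (θ : Θ) (δ c : ℝ) (ℓ n : ℕ) : Set Ω :=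
  {ω | (∫ u, M.llr ℓ (ℓ + n) u ω ∂(W[|Metric.ball θ δ])) / n < c}

/-- The weak left-tail condition, for every fixed `ℓ ≥ ν`. -/
def LeftTail (M : ChangePointModel Ω 𝓧 Θ) (W : Measure Θ) (I : Θ → ℝ) : Prop :=
  ∀ (ν : ℕ) (θ : Θ), ∀ ε > 0, ∀ ℓ ≥ ν, Tendsto (fun δ : ℝ =>
    limsup (fun n : ℕ => M.P ν θ (M.lowEvent W θ δ (I θ - ε) ℓ n)) atTop) (𝓝[>] 0) (𝓝 0)

/-- The weak left-tail condition, uniformly in `ℓ ≥ ν`. -/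
def UniformLeftTail (M : ChangePointModel Ω 𝓧 Θ) (W : Measure Θ) (I : Θ → ℝ) : Prop :=
  ∀ (ν : ℕ) (θ : Θ), ∀ ε > 0, Tendsto (fun δ : ℝ =>
    limsup (fun n : ℕ => ⨆ ℓ ≥ ν, M.P ν θ (M.lowEvent W θ δ (I θ - ε) ℓ n)) atTop)
      (𝓝[>] 0) (𝓝 0)

end Metric

end ChangePointModel

/-- `R_α ∼ (|log α| / I)^r` as `α → 0+`. -/
def FirstOrder (R : ℝ → ℝ≥0∞) (I r : ℝ) : Prop :=
  Tendsto (fun α : ℝ => R α / ENNReal.ofReal ((|Real.log α| / I) ^ r)) (𝓝[>] 0) (𝓝 1)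

/-- Admissible thresholds: `PFA(T_{a_α}) ≤ α` for all small `α`, and `a_α ∼ |log α|`. -/
def AdmissibleThreshold {Ω 𝓧 Θ : Type*} [MeasurableSpace Ω] [MeasurableSpace 𝓧]
    [MeasurableSpace Θ] (M : ChangePointModel Ω 𝓧 Θ) (W : Measure Θ) (ϱ a : ℝ → ℝ) : Prop :=
  (∀ᶠ α in 𝓝[>] (0 : ℝ), M.pfa (ϱ α) (M.wsrTime W (a α)) ≤ ENNReal.ofReal α) ∧
    Tendsto (fun α => a α / |Real.log α|) (𝓝[>] 0) (𝓝 1)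

/-! Everything rests on the likelihood ratio of `P ν θ` with respect to `Pinf` on the first `n`
observations (`lintegral_P`).

Lower bound. For `τ` in the class, `Pinf (τ ≤ N) ≤ α (1 - ϱ)^(-N)`. Passing to `P ν θ` costs a
factor `e^C` outside the event that the log-likelihood ratio reaches `C`. Take `N - ν` about `κ |log
α| / I` with `κ < 1`, and `C` slightly above `I (N - ν)`: that event is rare by the right-tail
condition, and `e^C α (1 - ϱ)^(-N)` tends to `0` because `ϱ → 0`. So, uniformly in `τ`, stopping by
time `N` is unlikely, and Markov's inequality bounds every moment from below (`eventually_le_risk`).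

Upper bound. `R_e^W` dominates the weighted likelihood ratio of any single block `[s, e)`, and by
Jensen the logarithm of the latter is at least `log W(Γ_δ)` plus the `Γ_δ`-average of the
log-likelihood ratio. Cut the time after `ν` into dyadic blocks, the first of length `K` about `|log
α| / I`. If each block misses the threshold with probability at most `η`, independence gives `P(T >
t_m | T > ν) ≤ η^m`, while `t_m - ν` is only of order `2^m K`. Hence the `r`-th moment is at most
`K^r / (1 - 2^r η)` (`risk_wsrTime_le`), and a condition on probabilities alone controls all
moments.

The non-uniform left-tail condition says nothing about blocks whose starting point moves to
infinity. For `[ν + n, ν + 2n)` the average is the one over `[ν, ν + 2n)` minus the one over `[ν, ν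
+ n)`. The first is large by the left-tail condition. The second cannot be too large, since the
weighted likelihood ratio rarely exceeds the likelihood ratio at the true `θ` by an exponential
factor (`P_weightedLR_ge_le`, `P_lowBlock_second_le`).

Independence is assumed for random functions on `Θ` with the product σ-algebra, for which integrals
over `Θ` need not be measurable. They are so up to null sets (`integral_ae_eq_condExp`), which
suffices. -/

namespace ChangePointModel

/-! ### Likelihood ratios and change of measure. -/

section LikelihoodRatio

variable {Ω 𝓧 Θ : Type*} [MeasurableSpace Ω] [MeasurableSpace 𝓧] [MeasurableSpace Θ]
  (M : ChangePointModel Ω 𝓧 Θ)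

instance : IsProbabilityMeasure M.Pinf := M.isProbabilityMeasure_Pinf

instance (ν : ℕ) (θ : Θ) : IsProbabilityMeasure (M.P ν θ) := M.isProbabilityMeasure_P ν θ

instance : SigmaFinite M.μ := M.sigmaFinite_μ

/-- The vector of the first `n` observations. -/
def obsVec (n : ℕ) (ω : Ω) : Fin n → 𝓧 := fun i => M.X i ω

lemma measurable_obsVec (n : ℕ) : Measurable (M.obsVec n) :=
  measurable_pi_lambda _ fun i => M.measurable_X i

lemma obsFiltration_eq_comap (n : ℕ) :
    M.obsFiltration n = MeasurableSpace.comap (M.obsVec n) MeasurableSpace.pi := by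
  simp only [MeasurableSpace.pi, MeasurableSpace.comap_iSup, MeasurableSpace.comap_comp]
  rfl

lemma measurable_obsVec_obsFiltration (n : ℕ) : Measurable[M.obsFiltration n] (M.obsVec n) := by
  rw [obsFiltration_eq_comap]
  exact comap_measurable _

/-- The likelihood ratio `∏_{k ≤ i < n} f_{θ,i} / ψ_i`. -/
noncomputable def lr (k n : ℕ) (θ : Θ) (ω : Ω) : ℝ≥0∞ :=
  ∏ i ∈ Finset.Ico k n, (M.ratio i θ ω : ℝ≥0∞)

/-- The likelihood ratio as a function of the observed values. -/
noncomputable def lrVec (k n : ℕ) (θ : Θ) (x : Fin n → 𝓧) : ℝ≥0∞ :=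
  ∏ i : Fin n, if (i : ℕ) < k then 1 else
    ((M.f θ i (fun j => x (Fin.castLE i.2.le j)) (x i) /
      M.ψ i (fun j => x (Fin.castLE i.2.le j)) (x i) : ℝ≥0) : ℝ≥0∞)

lemma lr_eq_lrVec (k n : ℕ) (θ : Θ) (ω : Ω) : M.lr k n θ ω = M.lrVec k n θ (M.obsVec n ω) := by
  have h1 : M.lrVec k n θ (M.obsVec n ω) =
      ∏ i : Fin n, (fun j : ℕ => if j < k then 1 else (M.ratio j θ ω : ℝ≥0∞)) i := rfl
  rw [h1, Fin.prod_univ_eq_prod_range (fun j : ℕ => if j < k then 1 else (M.ratio j θ ω : ℝ≥0∞)),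
    lr]
  have h2 : Finset.Ico k n = (Finset.range n).filter fun j => ¬ j < k := by
    ext j; simp; omega
  rw [h2, Finset.prod_filter]
  exact Finset.prod_congr rfl fun j _ => by split_ifs <;> simp_all

lemma measurable_lrVec (k n : ℕ) :
    Measurable fun p : Θ × (Fin n → 𝓧) => M.lrVec k n p.1 p.2 := by
  refine Finset.measurable_prod _ fun i _ => ?_
  split_ifs
  · exact measurable_const
  · refine measurable_coe_nnreal_ennreal.comp (Measurable.div ?_ ?_)
    · have : Measurable fun p : Θ × (Fin n → 𝓧) =>
          (p.1, (fun j : Fin i => p.2 (Fin.castLE i.2.le j)), p.2 i) := by fun_prop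
      exact (M.measurable_f i).comp this
    · have : Measurable fun p : Θ × (Fin n → 𝓧) =>
          ((fun j : Fin i => p.2 (Fin.castLE i.2.le j)), p.2 i) := by fun_prop
      exact (M.measurable_ψ i).comp this

lemma measurable_ratio_uncurry (i : ℕ) : Measurable fun p : Θ × Ω => M.ratio i p.1 p.2 := by
  have hX := M.measurable_X
  refine Measurable.div ?_ ?_
  · have : Measurable fun p : Θ × Ω => (p.1, (fun j : Fin i => M.X j p.2), M.X i p.2) := by
      fun_prop
    exact (M.measurable_f i).comp this
  · have : Measurable fun p : Θ × Ω => ((fun j : Fin i => M.X j p.2), M.X i p.2) := by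
      fun_prop
    exact (M.measurable_ψ i).comp this

lemma measurable_ratio (i : ℕ) (θ : Θ) : Measurable (M.ratio i θ) :=
  (M.measurable_ratio_uncurry i).comp (measurable_const.prodMk measurable_id)

lemma measurable_lr_uncurry (k n : ℕ) : Measurable fun p : Θ × Ω => M.lr k n p.1 p.2 :=
  Finset.measurable_prod _ fun i _ =>
    measurable_coe_nnreal_ennreal.comp (M.measurable_ratio_uncurry i)

lemma measurable_lr_obsFiltration (k n : ℕ) (θ : Θ) :
    Measurable[M.obsFiltration n] (M.lr k n θ) := by
  have : M.lr k n θ = (M.lrVec k n θ) ∘ M.obsVec n := funext fun ω => M.lr_eq_lrVec k n θ ω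
  rw [this]
  exact ((M.measurable_lrVec k n).comp (measurable_const.prodMk measurable_id)).comp
    (M.measurable_obsVec_obsFiltration n)

lemma measurable_lr (k n : ℕ) (θ : Θ) : Measurable (M.lr k n θ) :=
  (M.measurable_lr_uncurry k n).comp (measurable_const.prodMk measurable_id)

lemma weightedLR_eq (W : Measure Θ) (k n : ℕ) (ω : Ω) :
    M.weightedLR W k n ω = ∫⁻ θ, M.lr k n θ ω ∂W := rfl

lemma measurable_weightedLR_obsFiltration (W : Measure Θ) [SFinite W] (k n : ℕ) :
    Measurable[M.obsFiltration n] (M.weightedLR W k n) := by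
  have : M.weightedLR W k n = (fun x => ∫⁻ θ, M.lrVec k n θ x ∂W) ∘ M.obsVec n :=
    funext fun ω => lintegral_congr fun θ => M.lr_eq_lrVec k n θ ω
  rw [this]
  exact (M.measurable_lrVec k n).lintegral_prod_left'.comp (M.measurable_obsVec_obsFiltration n)

lemma measurable_weightedLR (W : Measure Θ) [SFinite W] (k n : ℕ) :
    Measurable (M.weightedLR W k n) :=
  (M.measurable_weightedLR_obsFiltration W k n).mono (M.obsFiltration.le n) le_rfl

lemma measurable_wsrStat_obsFiltration (W : Measure Θ) [SFinite W] (n : ℕ) :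
    Measurable[M.obsFiltration n] (M.wsrStat W n) :=
  Finset.measurable_fun_sum _ fun k _ => M.measurable_weightedLR_obsFiltration W k n

variable {M}

/-- Change of measure between `P ν θ` and `Pinf` on the first `n` observations. -/
lemma lintegral_P (hM : M.CommonSupport) (ν : ℕ) (θ : Θ) (n : ℕ) {g : Ω → ℝ≥0∞}
    (hg : Measurable[M.obsFiltration n] g) :
    ∫⁻ ω, g ω ∂(M.P ν θ) = ∫⁻ ω, M.lr ν n θ ω * g ω ∂M.Pinf := by
  rw [obsFiltration_eq_comap] at hg
  obtain ⟨h, hh, rfl⟩ := hg.exists_eq_measurable_comp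
  have hlr : Measurable (M.lrVec ν n θ) :=
    (M.measurable_lrVec ν n).comp (measurable_const.prodMk measurable_id)
  have hψ : Measurable fun x : Fin n → 𝓧 => ∏ i : Fin n,
      (M.ψ i (fun j => x (Fin.castLE i.2.le j)) (x i) : ℝ≥0∞) := by
    refine Finset.measurable_prod _ fun i _ => measurable_coe_nnreal_ennreal.comp ?_
    have : Measurable fun x : Fin n → 𝓧 =>
        ((fun j : Fin i => x (Fin.castLE i.2.le j)), x i) := by fun_prop
    exact (M.measurable_ψ i).comp this
  have hdens : (fun x : Fin n → 𝓧 => ∏ i : Fin n, (if (i : ℕ) < ν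
        then (M.ψ i (fun j => x (Fin.castLE i.2.le j)) (x i) : ℝ≥0∞)
        else (M.f θ i (fun j => x (Fin.castLE i.2.le j)) (x i) : ℝ≥0∞))) =
      (fun x : Fin n → 𝓧 => ∏ i : Fin n,
        (M.ψ i (fun j => x (Fin.castLE i.2.le j)) (x i) : ℝ≥0∞)) * M.lrVec ν n θ := by
    funext x
    rw [Pi.mul_apply, lrVec, ← Finset.prod_mul_distrib]
    refine Finset.prod_congr rfl fun i _ => ?_
    split_ifs
    · simp
    · rw [← ENNReal.coe_mul]
      congr 1
      -- Where `ψ = 0` the quotient is `0` by convention; common support makes `f = 0` there, so `ψ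
      -- * (f / ψ) = f` everywhere.
      by_cases h0 : M.ψ i (fun j => x (Fin.castLE i.2.le j)) (x i) = 0
      · rw [h0, (hM θ i _ _).2 h0, zero_mul]
      · field_simp
  have e1 : ∫⁻ ω, (h ∘ M.obsVec n) ω ∂(M.P ν θ) = ∫⁻ x, h x ∂((M.P ν θ).map (M.obsVec n)) :=
    (lintegral_map hh (M.measurable_obsVec n)).symm
  have e2 : ∫⁻ ω, M.lr ν n θ ω * (h ∘ M.obsVec n) ω ∂M.Pinf =
      ∫⁻ x, (M.lrVec ν n θ * h) x ∂(M.Pinf.map (M.obsVec n)) := by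
    rw [lintegral_map (hlr.mul hh) (M.measurable_obsVec n)]
    exact lintegral_congr fun ω => by simp [lr_eq_lrVec]
  rw [e1, e2]
  have l1 := M.law_P ν θ n
  have l2 := M.law_Pinf n
  rw [hdens] at l1
  change (M.P ν θ).map (M.obsVec n) = _ at l1
  change M.Pinf.map (M.obsVec n) = _ at l2
  rw [l1, l2, lintegral_withDensity_eq_lintegral_mul _ (hψ.mul hlr) hh,
    lintegral_withDensity_eq_lintegral_mul _ hψ (hlr.mul hh), mul_assoc]

lemma P_apply (hM : M.CommonSupport) (ν : ℕ) (θ : Θ) (n : ℕ) {A : Set Ω}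
    (hA : MeasurableSet[M.obsFiltration n] A) :
    M.P ν θ A = ∫⁻ ω in A, M.lr ν n θ ω ∂M.Pinf := by
  have hA' := M.obsFiltration.le n _ hA
  have hm : Measurable[M.obsFiltration n] (A.indicator (1 : Ω → ℝ≥0∞)) :=
    measurable_const.indicator hA
  rw [← lintegral_indicator_one hA', lintegral_P hM ν θ n hm, ← lintegral_indicator hA']
  exact lintegral_congr fun ω => by by_cases h : ω ∈ A <;> simp [h]

lemma P_inter_le (hM : M.CommonSupport) (ν : ℕ) (θ : Θ) (n : ℕ) {A : Set Ω}
    (hA : MeasurableSet[M.obsFiltration n] A) (C : ℝ≥0∞) :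
    M.P ν θ (A ∩ {ω | M.lr ν n θ ω ≤ C}) ≤ C * M.Pinf A := by
  have hlr := M.measurable_lr_obsFiltration ν n θ
  have hm : MeasurableSet[M.obsFiltration n] (A ∩ {ω | M.lr ν n θ ω ≤ C}) :=
    hA.inter (hlr measurableSet_Iic)
  rw [P_apply hM ν θ n hm]
  calc ∫⁻ ω in A ∩ {ω | M.lr ν n θ ω ≤ C}, M.lr ν n θ ω ∂M.Pinf
      ≤ ∫⁻ _ in A ∩ {ω | M.lr ν n θ ω ≤ C}, C ∂M.Pinf :=
        setLIntegral_mono' (M.obsFiltration.le n _ hm) fun ω hω => hω.2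
    _ ≤ C * M.Pinf A := by
        rw [setLIntegral_const]
        gcongr
        exact inter_subset_left

lemma measurableSet_psi_eq_zero (i : ℕ) : MeasurableSet[M.obsFiltration (i + 1)]
    {ω | M.ψ i (fun j => M.X j ω) (M.X i ω) = 0} := by
  have : Measurable fun x : Fin (i + 1) → 𝓧 =>
      ((fun j : Fin i => x (Fin.castLE (Fin.last i).2.le j)), x (Fin.last i)) := by fun_prop
  exact ((M.measurable_ψ i).comp this).comp (M.measurable_obsVec_obsFiltration (i + 1))
    (measurableSet_singleton 0)

lemma Pinf_psi_eq_zero (i : ℕ) : M.Pinf {ω | M.ψ i (fun j => M.X j ω) (M.X i ω) = 0} = 0 := by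
  let S : Set (Fin (i + 1) → 𝓧) :=
    {x | M.ψ i (fun j => x (Fin.castLE (Fin.last i).2.le j)) (x (Fin.last i)) = 0}
  have hS : MeasurableSet S := by
    have : Measurable fun x : Fin (i + 1) → 𝓧 =>
        ((fun j : Fin i => x (Fin.castLE (Fin.last i).2.le j)), x (Fin.last i)) := by fun_prop
    exact (M.measurable_ψ i).comp this (measurableSet_singleton 0)
  have h0 : M.Pinf.map (M.obsVec (i + 1)) S = 0 := by
    have l2 := M.law_Pinf (i + 1)
    change M.Pinf.map (M.obsVec (i + 1)) = _ at l2
    rw [l2, withDensity_apply _ hS, setLIntegral_congr_fun (g := 0) hS, Pi.zero_def,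
      lintegral_zero]
    intro x hx
    refine Finset.prod_eq_zero (Finset.mem_univ (Fin.last i)) ?_
    simpa [S] using hx
  rwa [Measure.map_apply (M.measurable_obsVec _) hS] at h0

/-- Needed because `Real.log 0 = 0`: the likelihood ratio is the exponential of `llr` only where all
ratios are positive. By common support the exceptional set does not depend on `u`. -/
lemma ae_ratio_pos (hM : M.CommonSupport) {Q : Measure Ω}
    (hQ : ∀ i, Q {ω | M.ψ i (fun j => M.X j ω) (M.X i ω) = 0} = 0) :
    ∀ᵐ ω ∂Q, ∀ i u, 0 < M.ratio i u ω := by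
  refine ae_all_iff.2 fun i => ?_
  filter_upwards [measure_eq_zero_iff_ae_notMem.1 (hQ i)] with ω hω u
  exact div_pos (pos_iff_ne_zero.2 ((hM u i _ _).not.2 hω)) (pos_iff_ne_zero.2 hω)

lemma Pinf_ae_ratio_pos (hM : M.CommonSupport) : ∀ᵐ ω ∂M.Pinf, ∀ i u, 0 < M.ratio i u ω :=
  ae_ratio_pos hM Pinf_psi_eq_zero

lemma P_ae_ratio_pos (hM : M.CommonSupport) (ν : ℕ) (θ : Θ) :
    ∀ᵐ ω ∂(M.P ν θ), ∀ i u, 0 < M.ratio i u ω := by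
  refine ae_ratio_pos hM fun i => ?_
  rw [P_apply hM ν θ (i + 1) (measurableSet_psi_eq_zero i)]
  exact setLIntegral_measure_zero _ _ (Pinf_psi_eq_zero i)

/-- Change of measure between `P ν θ` and `P 0 θ` on the first `n ≥ ν` observations. -/
lemma P_apply_P_zero (hM : M.CommonSupport) {ν n : ℕ} (h : ν ≤ n) (θ : Θ) {A : Set Ω}
    (hA : MeasurableSet[M.obsFiltration n] A) :
    M.P ν θ A = ∫⁻ ω in A, (M.lr 0 ν θ ω)⁻¹ ∂(M.P 0 θ) := by
  have hlr := (M.measurable_lr_obsFiltration 0 ν θ).mono (M.obsFiltration.mono h) le_rfl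
  rw [P_apply hM ν θ n hA, ← lintegral_indicator (M.obsFiltration.le n _ hA),
    ← lintegral_indicator (M.obsFiltration.le n _ hA),
    lintegral_P hM 0 θ n (g := A.indicator fun ω => (M.lr 0 ν θ ω)⁻¹) (hlr.inv.indicator hA)]
  refine lintegral_congr_ae ?_
  filter_upwards [Pinf_ae_ratio_pos hM] with ω hω
  by_cases hωA : ω ∈ A
  · have e : M.lr 0 n θ ω = M.lr 0 ν θ ω * M.lr ν n θ ω :=
      (Finset.prod_Ico_consecutive _ (Nat.zero_le _) h).symm
    have h0 : M.lr 0 ν θ ω ≠ 0 :=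
      Finset.prod_ne_zero_iff.2 fun i _ => by simpa using (hω i θ).ne'
    have h1 : M.lr 0 ν θ ω ≠ ∞ := ENNReal.prod_ne_top fun i _ => ENNReal.coe_ne_top
    simp only [hωA, indicator_of_mem]
    rw [e, mul_comm (M.lr 0 ν θ ω), mul_assoc, ENNReal.mul_inv_cancel h0 h1, mul_one]
  · simp [hωA]

end LikelihoodRatio

end ChangePointModel

namespace ChangePointModel

/-! ### False alarm probabilities. -/

section FalseAlarm

variable {Ω 𝓧 Θ : Type*} [MeasurableSpace Ω] [MeasurableSpace 𝓧] [MeasurableSpace Θ]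
  {M : ChangePointModel Ω 𝓧 Θ} {W : Measure Θ} {a : ℝ}

lemma coe_le_log_iff (a : ℝ) (x : ℝ≥0∞) :
    (a : EReal) ≤ ENNReal.log x ↔ ENNReal.ofReal (Real.exp a) ≤ x := by
  rw [← ENNReal.log_le_log_iff, ENNReal.log_ofReal_of_pos (Real.exp_pos a), Real.log_exp]

lemma lt_wsrTime_iff (n : ℕ) (ω : Ω) : (n : ℕ∞) < M.wsrTime W a ω ↔
    ∀ k ∈ Finset.Icc 1 n, M.wsrStat W k ω < ENNReal.ofReal (Real.exp a) := by
  rw [wsrTime, ← ENat.add_one_le_iff (ENat.natCast_ne_top n)]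
  simp only [le_iInf_iff, coe_le_log_iff, Finset.mem_Icc]
  constructor
  · intro h k hk
    by_contra! hc
    have := h k ⟨hk.1, hc⟩
    norm_cast at this
    omega
  · rintro h k ⟨hk, hc⟩
    norm_cast
    by_contra! h'
    exact (h k ⟨hk, by omega⟩).not_ge hc

lemma measurableSet_lt_wsrTime [SFinite W] (n : ℕ) :
    MeasurableSet[M.obsFiltration n] {ω | (n : ℕ∞) < M.wsrTime W a ω} := by
  have : {ω | (n : ℕ∞) < M.wsrTime W a ω} =
      ⋂ k ∈ Finset.Icc 1 n, M.wsrStat W k ⁻¹' Iio (ENNReal.ofReal (Real.exp a)) := by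
    ext ω; simp only [mem_ofPred_eq, lt_wsrTime_iff, mem_iInter, mem_preimage, mem_Iio]
  rw [this]
  refine Finset.measurableSet_biInter _ fun k hk => ?_
  exact M.obsFiltration.mono (Finset.mem_Icc.1 hk).2 _
    (M.measurable_wsrStat_obsFiltration W k measurableSet_Iio)

lemma isStoppingTime_wsrTime [SFinite W] : IsStoppingTime M.obsFiltration (M.wsrTime W a) := by
  intro n
  have := (measurableSet_lt_wsrTime (M := M) (W := W) (a := a) n).compl
  convert this using 1
  ext ω
  simp only [mem_compl_iff, mem_ofPred_eq, not_lt]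
  rfl

lemma measurable_P_apply (hM : M.CommonSupport) (j n : ℕ) {A : Set Ω}
    (hA : MeasurableSet[M.obsFiltration n] A) : Measurable fun u => M.P j u A := by
  simp only [P_apply hM j _ n hA]
  exact (M.measurable_lr_uncurry j n).lintegral_prod_right'

lemma setLIntegral_weightedLR (hM : M.CommonSupport) [SFinite W] (j n : ℕ) {A : Set Ω}
    (hA : MeasurableSet[M.obsFiltration n] A) :
    ∫⁻ ω in A, M.weightedLR W j n ω ∂M.Pinf = ∫⁻ u, M.P j u A ∂W := by
  simp only [P_apply hM j _ n hA, weightedLR_eq]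
  exact lintegral_lintegral_swap
    ((M.measurable_lr_uncurry j n).comp measurable_swap).aemeasurable

/-- Each of the `n` terms of `R_n^W` is a mixture of likelihood ratios, so integrating it over an
event known at time `n` gives a mixture of probabilities `P j u`. For fixed `j` and `u` the
first-crossing events are disjoint, so each `j < k` contributes at most `1`. -/
lemma Pinf_wsrTime_le (hM : M.CommonSupport) [IsProbabilityMeasure W] (k : ℕ) :
    ENNReal.ofReal (Real.exp a) * M.Pinf {ω | M.wsrTime W a ω ≤ (k : ℕ∞)} ≤ k := by
  set b := ENNReal.ofReal (Real.exp a)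
  -- `A n` is the event that the threshold is first reached at time `n`.
  let A : ℕ → Set Ω := fun n =>
    {ω | b ≤ M.wsrStat W n ω ∧ ∀ j ∈ Finset.Ico 1 n, M.wsrStat W j ω < b}
  have hA : ∀ n, MeasurableSet[M.obsFiltration n] (A n) := by
    intro n
    have : A n = (M.wsrStat W n ⁻¹' Ici b) ∩ ⋂ j ∈ Finset.Ico 1 n, M.wsrStat W j ⁻¹' Iio b := by
      ext ω; simp [A]
    rw [this]
    refine (M.measurable_wsrStat_obsFiltration W n measurableSet_Ici).inter
      (Finset.measurableSet_biInter _ fun j hj => ?_)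
    exact M.obsFiltration.mono (Finset.mem_Ico.1 hj).2.le _
      (M.measurable_wsrStat_obsFiltration W j measurableSet_Iio)
  have hcover : {ω | M.wsrTime W a ω ≤ (k : ℕ∞)} ⊆ ⋃ n ∈ Finset.Icc 1 k, A n := by
    intro ω hω
    rw [mem_ofPred_eq, ← not_lt, lt_wsrTime_iff] at hω
    push Not at hω
    classical
    have hex : ∃ n, 1 ≤ n ∧ b ≤ M.wsrStat W n ω := by
      obtain ⟨n, hn, hb⟩ := hω
      exact ⟨n, (Finset.mem_Icc.1 hn).1, hb⟩
    obtain ⟨n, hn, hb⟩ := hω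
    refine mem_biUnion (x := Nat.find hex) ?_ ⟨(Nat.find_spec hex).2, fun j hj => ?_⟩
    · exact Finset.mem_coe.2 (Finset.mem_Icc.2 ⟨(Nat.find_spec hex).1,
        (Nat.find_min' hex ⟨(Finset.mem_Icc.1 hn).1, hb⟩).trans (Finset.mem_Icc.1 hn).2⟩)
    · have := Nat.find_min hex (Finset.mem_Ico.1 hj).2
      push Not at this
      exact this (Finset.mem_Ico.1 hj).1
  have hdisj : (↑(Finset.Icc 1 k) : Set ℕ).PairwiseDisjoint A := by
    have key : ∀ m n, 1 ≤ m → m < n → Disjoint (A m) (A n) := fun m n h1 h2 =>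
      Set.disjoint_left.2 fun ω hm hn =>
        (hn.2 m (Finset.mem_Ico.2 ⟨h1, h2⟩)).not_ge hm.1
    intro m hm n hn hne
    rcases lt_or_gt_of_ne hne with h | h
    · exact key m n (Finset.mem_Icc.1 hm).1 h
    · exact (key n m (Finset.mem_Icc.1 hn).1 h).symm
  have hone : ∀ n, b * M.Pinf (A n) ≤ ∑ j ∈ Finset.range n, ∫⁻ u, M.P j u (A n) ∂W := by
    intro n
    calc b * M.Pinf (A n) = ∫⁻ _ in A n, b ∂M.Pinf := (setLIntegral_const _ _).symm
      _ ≤ ∫⁻ ω in A n, M.wsrStat W n ω ∂M.Pinf :=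
          setLIntegral_mono' (M.obsFiltration.le n _ (hA n)) fun ω hω => hω.1
      _ = ∑ j ∈ Finset.range n, ∫⁻ ω in A n, M.weightedLR W j n ω ∂M.Pinf :=
          lintegral_finsetSum _ fun j _ => M.measurable_weightedLR W j n
      _ = _ := Finset.sum_congr rfl fun j _ => setLIntegral_weightedLR hM j n (hA n)
  calc b * M.Pinf {ω | M.wsrTime W a ω ≤ (k : ℕ∞)}
      ≤ b * ∑ n ∈ Finset.Icc 1 k, M.Pinf (A n) := by
        gcongr
        exact (measure_mono hcover).trans (measure_biUnion_finset_le _ _)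
    _ ≤ ∑ n ∈ Finset.Icc 1 k, ∑ j ∈ Finset.range k, ∫⁻ u, M.P j u (A n) ∂W := by
        rw [Finset.mul_sum]
        refine Finset.sum_le_sum fun n hn => (hone n).trans ?_
        exact Finset.sum_le_sum_of_subset
          (Finset.range_subset_range.2 (Finset.mem_Icc.1 hn).2)
    _ = ∑ j ∈ Finset.range k, ∫⁻ u, ∑ n ∈ Finset.Icc 1 k, M.P j u (A n) ∂W := by
        rw [Finset.sum_comm]
        refine Finset.sum_congr rfl fun j _ => ?_
        rw [lintegral_finsetSum _ fun n _ => measurable_P_apply hM j n (hA n)]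
    _ ≤ ∑ j ∈ Finset.range k, ∫⁻ _, 1 ∂W := by
        refine Finset.sum_le_sum fun j _ => lintegral_mono fun u => ?_
        rw [← measure_biUnion_finset hdisj fun n _ => M.obsFiltration.le n _ (hA n)]
        exact prob_le_one
    _ = k := by simp

/-- The mean of the geometric prior is `(1 - ϱ) / ϱ`; divided by `e^a` it is exactly `α` for this
threshold. -/
lemma pfa_wsrTime_le (hM : M.CommonSupport) [IsProbabilityMeasure W] {α ϱ : ℝ}
    (hα : 0 < α) (hϱ : ϱ ∈ Ioo (0 : ℝ) 1) :
    M.pfa ϱ (M.wsrTime W (Real.log ((1 - ϱ) / (ϱ * α)))) ≤ ENNReal.ofReal α := by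
  obtain ⟨h0, h1⟩ := hϱ
  set b := (1 - ϱ) / (ϱ * α) with hb
  have hb0 : 0 < b := div_pos (by linarith) (by positivity)
  have hnorm : ‖1 - ϱ‖ < 1 := by rw [Real.norm_eq_abs, abs_lt]; constructor <;> linarith
  have hs := hasSum_coe_mul_geometric_of_norm_lt_one hnorm
  have hs2 : HasSum (fun k : ℕ => ϱ / b * (k * (1 - ϱ) ^ k)) α := by
    have e : ϱ / b * ((1 - ϱ) / (1 - (1 - ϱ)) ^ 2) = α := by
      rw [hb, sub_sub_cancel]
      have : 1 - ϱ ≠ 0 := by linarith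
      field_simp
    exact e ▸ hs.mul_left (ϱ / b)
  have hnn : ∀ k : ℕ, 0 ≤ ϱ / b * (k * (1 - ϱ) ^ k) := fun k => by
    have : 0 ≤ 1 - ϱ := by linarith
    positivity
  calc M.pfa ϱ (M.wsrTime W (Real.log b))
      ≤ ∑' k : ℕ, ENNReal.ofReal (ϱ / b * (k * (1 - ϱ) ^ k)) := by
        refine ENNReal.tsum_le_tsum fun k => ?_
        have h := Pinf_wsrTime_le (a := Real.log b) (W := W) hM k
        rw [Real.exp_log hb0] at h
        have h2 : M.Pinf {ω | M.wsrTime W (Real.log b) ω ≤ (k : ℕ∞)} ≤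
            ENNReal.ofReal (k / b) := by
          rw [ENNReal.ofReal_div_of_pos hb0, ENNReal.ofReal_natCast,
            ENNReal.le_div_iff_mul_le (Or.inl (by simpa using hb0)) (Or.inl ENNReal.ofReal_ne_top),
            mul_comm]
          exact h
        have hp : 0 ≤ ϱ * (1 - ϱ) ^ k := by
          have : 0 ≤ 1 - ϱ := by linarith
          positivity
        refine (mul_le_mul_right h2 _).trans ?_
        rw [← ENNReal.ofReal_mul hp]
        exact ENNReal.ofReal_le_ofReal (le_of_eq (by ring))
    _ = ENNReal.ofReal α := by rw [← ENNReal.ofReal_tsum_of_nonneg hnn hs2.summable, hs2.tsum_eq]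

lemma wsrTime_mem_bayesClass (hM : M.CommonSupport) [IsProbabilityMeasure W] {α ϱ : ℝ}
    (hα : 0 < α) (hϱ : ϱ ∈ Ioo (0 : ℝ) 1) :
    M.wsrTime W (Real.log ((1 - ϱ) / (ϱ * α))) ∈ M.bayesClass α ϱ :=
  ⟨isStoppingTime_wsrTime, pfa_wsrTime_le hM hα hϱ⟩

/-- A bound for the false alarm probability by time `n` in terms of the weighted one. -/
lemma Pinf_le_of_pfa_le {α ϱ : ℝ} (hϱ : ϱ ∈ Ioo (0 : ℝ) 1) {τ : Ω → ℕ∞}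
    (h : M.pfa ϱ τ ≤ ENNReal.ofReal α) (n : ℕ) :
    ENNReal.ofReal ((1 - ϱ) ^ n) * M.Pinf {ω | τ ω ≤ (n : ℕ∞)} ≤ ENNReal.ofReal α := by
  refine le_trans ?_ h
  obtain ⟨h0, h1⟩ := hϱ
  have hnorm : ‖1 - ϱ‖ < 1 := by rw [Real.norm_eq_abs, abs_lt]; constructor <;> linarith
  have hq : 0 ≤ 1 - ϱ := by linarith
  -- The prior mass of `{k ≥ n}` is `(1 - ϱ)^n`, and `{τ ≤ n}` is contained in `{τ ≤ k}` for these
  -- `k`.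
  have hs : HasSum (fun k : ℕ => ϱ * (1 - ϱ) ^ (k + n)) ((1 - ϱ) ^ n) := by
    have e : ϱ * (1 - ϱ) ^ n * (1 - (1 - ϱ))⁻¹ = (1 - ϱ) ^ n := by
      rw [sub_sub_cancel]
      field_simp
    have e' : (fun k : ℕ => ϱ * (1 - ϱ) ^ (k + n)) =
        fun k : ℕ => ϱ * (1 - ϱ) ^ n * (1 - ϱ) ^ k := by
      ext k; ring
    rw [e']
    have := (hasSum_geometric_of_norm_lt_one hnorm).mul_left (ϱ * (1 - ϱ) ^ n)
    rwa [e] at this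
  rw [← hs.tsum_eq, ENNReal.ofReal_tsum_of_nonneg (fun k => by positivity) hs.summable,
    ← ENNReal.tsum_mul_right]
  calc ∑' k : ℕ, ENNReal.ofReal (ϱ * (1 - ϱ) ^ (k + n)) * M.Pinf {ω | τ ω ≤ (n : ℕ∞)}
      ≤ ∑' k : ℕ, ENNReal.ofReal (ϱ * (1 - ϱ) ^ (k + n)) *
          M.Pinf {ω | τ ω ≤ ((k + n : ℕ) : ℕ∞)} := by
        refine ENNReal.tsum_le_tsum fun k => ?_
        gcongr
        omega
    _ ≤ M.pfa ϱ τ :=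
        ENNReal.tsum_comp_le_tsum_of_injective (add_left_injective n)
          (fun k => ENNReal.ofReal (ϱ * (1 - ϱ) ^ k) * M.Pinf {ω | τ ω ≤ (k : ℕ∞)})

end FalseAlarm

end ChangePointModel

/-! ### Measurability of averages up to null sets. -/

section Augmentation

variable {Ω Θ : Type*} {m m' mΩ : MeasurableSpace Ω}

/-- The measurable sets that agree almost surely with a set of `m`. -/
@[reducible] def augmentedSpace {Ω : Type*} (m : MeasurableSpace Ω) {mΩ : MeasurableSpace Ω}
    (Q : Measure Ω) : MeasurableSpace Ω :=
  eventuallyMeasurableSpace m (ae Q) ⊓ mΩ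

lemma augmentedSpace_le (Q : Measure Ω) : augmentedSpace m Q ≤ mΩ :=
  inf_le_right

lemma measurableSet_augmentedSpace_iff {Q : Measure Ω} {s : Set Ω} :
    MeasurableSet[augmentedSpace m Q] s ↔ (∃ t, MeasurableSet[m] t ∧ s =ᵐ[Q] t) ∧ MeasurableSet s :=
  MeasurableSpace.measurableSet_inf

lemma augmentedSpace_mono (h : m ≤ m') (Q : Measure Ω) :
    augmentedSpace m Q ≤ augmentedSpace m' Q := by
  intro s hs
  rw [measurableSet_augmentedSpace_iff] at hs ⊢
  obtain ⟨⟨t, ht, hst⟩, hs⟩ := hs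
  exact ⟨⟨t, h t ht, hst⟩, hs⟩

lemma augmentedSpace_augmentedSpace_le (Q : Measure Ω) :
    augmentedSpace (augmentedSpace m Q) Q ≤ augmentedSpace m Q := by
  intro s hs
  rw [measurableSet_augmentedSpace_iff] at hs ⊢
  obtain ⟨⟨t, ht, hst⟩, hs⟩ := hs
  obtain ⟨⟨t', ht', htt'⟩, -⟩ := measurableSet_augmentedSpace_iff.1 ht
  exact ⟨⟨t', ht', hst.trans htt'⟩, hs⟩

lemma measurable_augmentedSpace_of_ae_eq {β : Type*} [MeasurableSpace β]
    {Q : Measure Ω} {f g : Ω → β} (hf : Measurable[m] f) (hg : Measurable g) (hgf : g =ᵐ[Q] f) :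
    Measurable[augmentedSpace m Q] g := fun s hs =>
  measurableSet_augmentedSpace_iff.2 ⟨⟨f ⁻¹' s, hf hs, hgf.preimage s⟩, hg hs⟩

lemma indep_augmentedSpace {Q : Measure Ω} (h : Indep m m' Q) :
    Indep (augmentedSpace m Q) (augmentedSpace m' Q) Q := by
  rw [Indep_iff] at h ⊢
  intro s t hs ht
  rw [measurableSet_augmentedSpace_iff] at hs ht
  obtain ⟨⟨s', hs', hss⟩, -⟩ := hs
  obtain ⟨⟨t', ht', htt⟩, -⟩ := ht
  rw [measure_congr hss, measure_congr htt, measure_congr (hss.inter htt), h s' t' hs' ht']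

/-- If `g u` is bounded and `m`-measurable for every `u`, then its average over `u` is almost
surely equal to its conditional expectation given `m`. -/
lemma integral_ae_eq_condExp (hm : m ≤ mΩ) {Q : Measure Ω}
    [IsProbabilityMeasure Q] [MeasurableSpace Θ] {W : Measure Θ} [IsProbabilityMeasure W]
    {g : Θ → Ω → ℝ} (hg : Measurable fun p : Θ × Ω => g p.1 p.2) {C : ℝ} (hC : ∀ u ω, |g u ω| ≤ C)
    (hgm : ∀ u, Measurable[m] (g u)) :
    (fun ω => ∫ u, g u ω ∂W) =ᵐ[Q] Q[fun ω => ∫ u, g u ω ∂W | m] := by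
  set h : Ω → ℝ := fun ω => ∫ u, g u ω ∂W
  have hhm : Measurable h := hg.stronglyMeasurable.integral_prod_left'.measurable
  have hhC : ∀ ω, |h ω| ≤ C := fun ω => by
    have := norm_integral_le_of_norm_le_const (μ := W) (f := fun u => g u ω) (C := C)
      (ae_of_all _ fun u => by simpa using hC u ω)
    simpa using this
  have hC0 : 0 ≤ C := by
    obtain ⟨ω⟩ : Nonempty Ω := nonempty_of_isProbabilityMeasure Q
    exact (abs_nonneg _).trans (hhC ω)
  have hhi : Integrable h Q := Integrable.of_bound hhm.aestronglyMeasurable C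
    (ae_of_all _ fun ω => by simpa using hhC ω)
  set k : Ω → ℝ := Q[h | m]
  have hkm : StronglyMeasurable[m] k := stronglyMeasurable_condExp
  have hki : Integrable k Q := integrable_condExp
  have hkC : ∀ᵐ ω ∂Q, |k ω| ≤ C := by
    have := ae_bdd_abs_condExp_of_ae_bdd_abs (m := m) (R := C) (f := h) (μ := Q)
      (ae_of_all _ hhC)
    exact this
  set D : Ω → ℝ := fun ω => h ω - k ω
  have hDi : Integrable D Q := hhi.sub hki
  have hDm : Measurable D := hhm.sub (hkm.mono hm).measurable
  have hDC : ∀ᵐ ω ∂Q, |D ω| ≤ C + C := by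
    filter_upwards [hkC] with ω hω
    exact (abs_sub _ _).trans (add_le_add (hhC ω) hω)
  have hD0 : Q[D | m] =ᵐ[Q] 0 := by
    have h1 : Q[D | m] =ᵐ[Q] Q[h | m] - Q[k | m] := condExp_sub hhi hki m
    have h2 : Q[k | m] = k := condExp_of_stronglyMeasurable hm hkm hki
    rw [h2] at h1
    simpa [k] using h1
  -- `D` is orthogonal to bounded `m`-measurable functions
  have horth : ∀ f : Ω → ℝ, StronglyMeasurable[m] f → (∀ᵐ ω ∂Q, |f ω| ≤ C) →
      ∫ ω, D ω * f ω ∂Q = 0 := by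
    intro f hf hfC
    have hDf : Integrable (D * f) Q :=
      hDi.mul_bdd (hf.mono hm).aestronglyMeasurable (by simpa using hfC)
    have h1 := condExp_mul_of_stronglyMeasurable_right hf hDf hDi
    have h2 : ∫ ω, (D * f) ω ∂Q = ∫ ω, (Q[D * f | m]) ω ∂Q := (integral_condExp hm).symm
    change ∫ ω, (D * f) ω ∂Q = 0
    rw [h2, integral_congr_ae h1, ← integral_zero Ω ℝ (μ := Q)]
    refine integral_congr_ae ?_
    filter_upwards [hD0] with ω hω
    simp [hω]
  -- Each `g u` is `m`-measurable, hence orthogonal to `D`; Fubini passes this to the average `h`,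
  -- although `h` itself may fail to be `m`-measurable. As `D` is orthogonal to `k` too, `∫ D² = 0`.
  have hDh : ∫ ω, D ω * h ω ∂Q = 0 := by
    have e : ∀ ω, D ω * h ω = ∫ u, D ω * g u ω ∂W := fun ω => (integral_const_mul _ _).symm
    simp only [e]
    rw [integral_integral_swap]
    · rw [← integral_zero Θ ℝ (μ := W)]
      exact integral_congr_ae (ae_of_all _ fun u => horth (g u) (hgm u).stronglyMeasurable
        (ae_of_all _ (hC u)))
    · refine Integrable.of_bound (C := (C + C) * C) ?_ ?_
      · exact ((hDm.comp measurable_fst).mul (hg.comp measurable_swap)).aestronglyMeasurable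
      · have : ∀ᵐ p ∂(Q.prod W), |D p.1| ≤ C + C :=
          Measure.quasiMeasurePreserving_fst.ae hDC
        filter_upwards [this] with p hp
        simp only [Function.uncurry, norm_mul, Real.norm_eq_abs]
        exact mul_le_mul hp (hC _ _) (abs_nonneg _) (by positivity)
  have hDk : ∫ ω, D ω * k ω ∂Q = 0 := horth k hkm hkC
  have hD2 : ∫ ω, D ω * D ω ∂Q = 0 := by
    have e : ∀ ω, D ω * D ω = D ω * h ω - D ω * k ω := fun ω => by simp only [D]; ring
    simp only [e]
    rw [integral_sub, hDh, hDk, sub_zero]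
    · exact hDi.mul_bdd hhm.aestronglyMeasurable (ae_of_all _ (by simpa using hhC))
    · exact hDi.mul_bdd hki.aestronglyMeasurable (by simpa using hkC)
  have hDD : Integrable (fun ω => D ω * D ω) Q :=
    hDi.mul_bdd hDm.aestronglyMeasurable (by simpa using hDC)
  have := (integral_eq_zero_iff_of_nonneg (fun ω => mul_self_nonneg (D ω)) hDD).1 hD2
  filter_upwards [this] with ω hω
  have : D ω = 0 := mul_self_eq_zero.1 hω
  simpa [D, sub_eq_zero] using this

/-- Averages of `m`-measurable functions are `m`-measurable up to null sets. -/
lemma measurable_augmentedSpace_lintegral (hm : m ≤ mΩ) {Q : Measure Ω}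
    [IsProbabilityMeasure Q] [MeasurableSpace Θ] {W : Measure Θ} [IsProbabilityMeasure W]
    {g : Θ → Ω → ℝ≥0∞} (hg : Measurable fun p : Θ × Ω => g p.1 p.2)
    (hgm : ∀ u, Measurable[m] (g u)) :
    Measurable[augmentedSpace m Q] fun ω => ∫⁻ u, g u ω ∂W := by
  -- Truncation at `N` gives the boundedness required for the conditional expectation argument;
  -- monotone convergence removes it.
  have hbdd : ∀ N : ℕ, Measurable[augmentedSpace m Q] fun ω => ∫⁻ u, min (g u ω) N ∂W := by
    intro N
    have hgN : Measurable fun p : Θ × Ω => min (g p.1 p.2) (N : ℝ≥0∞) := hg.min measurable_const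
    have htop : ∀ x : ℝ≥0∞, min x (N : ℝ≥0∞) ≠ ∞ := fun x =>
      ne_top_of_le_ne_top (ENNReal.natCast_ne_top N) (min_le_right _ _)
    have key := integral_ae_eq_condExp hm (Q := Q) (W := W)
      (g := fun u ω => (min (g u ω) (N : ℝ≥0∞)).toReal) hgN.ennreal_toReal (C := N)
      (fun u ω => by
        rw [abs_of_nonneg ENNReal.toReal_nonneg]
        exact ENNReal.toReal_le_of_le_ofReal (by positivity)
          (by simp))
      (fun u => ((hgm u).min measurable_const).ennreal_toReal)
    refine measurable_augmentedSpace_of_ae_eq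
      (f := fun ω => ENNReal.ofReal
        ((Q[fun ω => ∫ u, (min (g u ω) (N : ℝ≥0∞)).toReal ∂W | m]) ω))
      (stronglyMeasurable_condExp.measurable.ennreal_ofReal) hgN.lintegral_prod_left' ?_
    filter_upwards [key] with ω hω
    rw [← hω, integral_toReal, ENNReal.ofReal_toReal]
    · refine ne_top_of_le_ne_top (ENNReal.natCast_ne_top N) ?_
      calc ∫⁻ u, min (g u ω) N ∂W ≤ ∫⁻ _, N ∂W := lintegral_mono fun u => min_le_right _ _
        _ = N := by simp
    · exact (hgN.comp (measurable_id.prodMk measurable_const)).aemeasurable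
    · exact ae_of_all _ fun u => (htop _).lt_top
  have hsup : (fun ω => ∫⁻ u, g u ω ∂W) = fun ω => ⨆ N : ℕ, ∫⁻ u, min (g u ω) N ∂W := by
    funext ω
    rw [← lintegral_iSup]
    · refine lintegral_congr fun u => ?_
      rw [← inf_iSup_eq, ENNReal.iSup_natCast, inf_top_eq]
    · exact fun N => (hg.comp (measurable_id.prodMk measurable_const)).min measurable_const
    · exact fun N N' h u => min_le_min_left _ (by exact_mod_cast h)
  rw [hsup]
  exact Measurable.iSup hbdd

end Augmentation

namespace ChangePointModel

/-! ### Independent dyadic blocks and the geometric bound for the delay. -/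

section Blocks

variable {Ω 𝓧 Θ : Type*} [MeasurableSpace Ω] [MeasurableSpace 𝓧] [MeasurableSpace Θ]
  {M : ChangePointModel Ω 𝓧 Θ} {W : Measure Θ} {a : ℝ}

lemma measurable_llrIncr (i : ℕ) (u : Θ) : Measurable (M.llrIncr i u) :=
  Real.measurable_log.comp (measurable_coe_nnreal_real.comp (M.measurable_ratio i u))

variable (M) in
/-- The σ-algebra generated by the increments `ΔZ_{i+1}(·)`, `s ≤ i < e`. -/
@[reducible] noncomputable def incrSpace (s e : ℕ) : MeasurableSpace Ω :=
  ⨆ i ∈ Ico s e, MeasurableSpace.comap (fun ω (u : Θ) => M.llrIncr i u ω) MeasurableSpace.pi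

lemma incrSpace_mono {s s' e e' : ℕ} (hs : s' ≤ s) (he : e ≤ e') :
    M.incrSpace s e ≤ M.incrSpace s' e' :=
  biSup_mono fun _ hi => ⟨hs.trans hi.1, hi.2.trans_le he⟩

lemma measurable_llrIncr_incrSpace {s e i : ℕ} (hi : i ∈ Ico s e) (u : Θ) :
    Measurable[M.incrSpace s e] (M.llrIncr i u) := by
  have h : Measurable[MeasurableSpace.comap (fun ω (u : Θ) => M.llrIncr i u ω)
      MeasurableSpace.pi] (M.llrIncr i u) :=
    (measurable_pi_apply u).comp (comap_measurable fun ω (u : Θ) => M.llrIncr i u ω)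
  exact h.mono (le_iSup₂ (f := fun (i : ℕ) (_ : i ∈ Ico s e) => MeasurableSpace.comap
    (fun ω (u : Θ) => M.llrIncr i u ω) MeasurableSpace.pi) i hi) le_rfl

lemma indep_incrSpace (hindep : M.IndepIncrements) (θ : Θ) (s e : ℕ) :
    Indep (M.incrSpace 0 s) (M.incrSpace s e) (M.P 0 θ) := by
  have h : iIndep (fun i : ℕ => MeasurableSpace.comap (fun ω (u : Θ) => M.llrIncr i u ω)
      MeasurableSpace.pi) (M.P 0 θ) := by
    have := (hindep 0 θ).iIndep
    simpa only [zero_add] using this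
  refine indep_iSup_of_disjoint (fun i =>
    (measurable_pi_lambda _ fun u => M.measurable_llrIncr i u).comap_le) h ?_
  exact Set.disjoint_left.2 fun i hi hi' => absurd hi.2 (not_lt.2 hi'.1)

lemma measurable_lr_augmentedSpace (hM : M.CommonSupport) (θ : Θ) (s e : ℕ) (u : Θ) :
    Measurable[augmentedSpace (M.incrSpace s e) (M.P 0 θ)] (M.lr s e u) := by
  refine measurable_augmentedSpace_of_ae_eq
    (f := fun ω => ∏ i ∈ Finset.Ico s e, ENNReal.ofReal (Real.exp (M.llrIncr i u ω)))
    ?_ (M.measurable_lr s e u) ?_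
  · refine Finset.measurable_prod _ fun i hi => ?_
    exact (Real.measurable_exp.comp
      (measurable_llrIncr_incrSpace (by simpa using hi) u)).ennreal_ofReal
  · filter_upwards [P_ae_ratio_pos hM 0 θ] with ω hω
    refine Finset.prod_congr rfl fun i _ => ?_
    rw [llrIncr, Real.exp_log (by exact_mod_cast hω i u), ENNReal.ofReal_coe_nnreal]

lemma measurable_weightedLR_augmentedSpace (hM : M.CommonSupport) [IsProbabilityMeasure W]
    (θ : Θ) (s e : ℕ) :
    Measurable[augmentedSpace (M.incrSpace s e) (M.P 0 θ)] (M.weightedLR W s e) := by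
  have := measurable_augmentedSpace_lintegral (W := W) (Q := M.P 0 θ)
    (augmentedSpace_le (m := M.incrSpace s e) (M.P 0 θ)) (M.measurable_lr_uncurry s e)
    (measurable_lr_augmentedSpace hM θ s e)
  exact this.mono (augmentedSpace_augmentedSpace_le _) le_rfl

lemma measurableSet_lt_wsrTime_augmentedSpace (hM : M.CommonSupport) [IsProbabilityMeasure W]
    (θ : Θ) (n : ℕ) : MeasurableSet[augmentedSpace (M.incrSpace 0 n) (M.P 0 θ)]
      {ω | (n : ℕ∞) < M.wsrTime W a ω} := by
  have : {ω | (n : ℕ∞) < M.wsrTime W a ω} =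
      ⋂ k ∈ Finset.Icc 1 n, M.wsrStat W k ⁻¹' Iio (ENNReal.ofReal (Real.exp a)) := by
    ext ω; simp only [mem_ofPred_eq, lt_wsrTime_iff, mem_iInter, mem_preimage, mem_Iio]
  rw [this]
  refine Finset.measurableSet_biInter _ fun k hk => ?_
  have hR : Measurable[augmentedSpace (M.incrSpace 0 n) (M.P 0 θ)] (M.wsrStat W k) :=
    Finset.measurable_fun_sum _ fun j _ =>
      (measurable_weightedLR_augmentedSpace hM θ j k).mono (augmentedSpace_mono
        (incrSpace_mono (Nat.zero_le _) (Finset.mem_Icc.1 hk).2) _) le_rfl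
  exact hR measurableSet_Iio

/-- Under `P ν θ` the increments after time `s ≥ ν` are independent of those before, with the
same distribution as under `P 0 θ`. -/
lemma P_inter_eq_mul (hM : M.CommonSupport) (hindep : M.IndepIncrements) (θ : Θ) {ν s e : ℕ}
    (hν : ν ≤ s) (he : s ≤ e) {A B : Set Ω} (hA : MeasurableSet[M.obsFiltration s] A)
    (hA' : MeasurableSet[augmentedSpace (M.incrSpace 0 s) (M.P 0 θ)] A)
    (hB : MeasurableSet[M.obsFiltration e] B)
    (hB' : MeasurableSet[augmentedSpace (M.incrSpace s e) (M.P 0 θ)] B) :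
    M.P ν θ (A ∩ B) = M.P ν θ A * M.P 0 θ B := by
  have hAm := M.obsFiltration.le s _ hA
  have hBm := M.obsFiltration.le e _ hB
  -- The density of `P ν θ` with respect to `P 0 θ` involves only the first `ν ≤ s` observations, so
  -- it belongs to the past of `s` and independence under `P 0 θ` suffices.
  have hw : Measurable[augmentedSpace (M.incrSpace 0 s) (M.P 0 θ)]
      (A.indicator fun ω => (M.lr 0 ν θ ω)⁻¹) := by
    refine Measurable.indicator (Measurable.inv ?_) hA'
    exact (measurable_lr_augmentedSpace hM θ 0 ν θ).mono
      (augmentedSpace_mono (incrSpace_mono le_rfl hν) _) le_rfl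
  have hone : Measurable[augmentedSpace (M.incrSpace s e) (M.P 0 θ)]
      (B.indicator (1 : Ω → ℝ≥0∞)) := measurable_const.indicator hB'
  rw [P_apply_P_zero hM (hν.trans he) θ ((M.obsFiltration.mono he _ hA).inter hB),
    P_apply_P_zero hM hν θ hA, ← lintegral_indicator (hAm.inter hBm),
    ← lintegral_indicator hAm, ← lintegral_indicator_one hBm,
    ← lintegral_mul_eq_lintegral_mul_lintegral_of_independent_measurableSpace
      (augmentedSpace_le _) (augmentedSpace_le _)
      (indep_augmentedSpace (indep_incrSpace hindep θ s e)) hw hone]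
  refine lintegral_congr fun ω => ?_
  by_cases h1 : ω ∈ A <;> by_cases h2 : ω ∈ B <;> simp [h1, h2]

variable (M) in
/-- The event that the weighted likelihood ratio of the block `[s, e)` stays below `b`. -/
def lowBlock (W : Measure Θ) (b : ℝ≥0∞) (s e : ℕ) : Set Ω := {ω | M.weightedLR W s e ω < b}

lemma measurableSet_lowBlock [SFinite W] (b : ℝ≥0∞) (s e : ℕ) :
    MeasurableSet[M.obsFiltration e] (M.lowBlock W b s e) :=
  M.measurable_weightedLR_obsFiltration W s e measurableSet_Iio

lemma measurableSet_lowBlock_augmentedSpace (hM : M.CommonSupport) [IsProbabilityMeasure W]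
    (θ : Θ) (b : ℝ≥0∞) (s e : ℕ) :
    MeasurableSet[augmentedSpace (M.incrSpace s e) (M.P 0 θ)] (M.lowBlock W b s e) :=
  measurable_weightedLR_augmentedSpace hM θ s e measurableSet_Iio

lemma P_lowBlock (hM : M.CommonSupport) (hindep : M.IndepIncrements) [IsProbabilityMeasure W]
    (θ : Θ) {ν s e : ℕ} (hν : ν ≤ s) (he : s ≤ e) (b : ℝ≥0∞) :
    M.P ν θ (M.lowBlock W b s e) = M.P 0 θ (M.lowBlock W b s e) := by
  have := P_inter_eq_mul hM hindep θ hν he (A := univ) MeasurableSet.univ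
    MeasurableSet.univ (measurableSet_lowBlock b s e)
    (measurableSet_lowBlock_augmentedSpace (W := W) hM θ b s e)
  simpa using this

/-- The last block is independent of all that precedes it. The event that no alarm is raised by `t
0` is kept as a factor so that it cancels in the conditional risk. -/
lemma P_lt_wsrTime_inter_lowBlock (hM : M.CommonSupport) (hindep : M.IndepIncrements)
    [IsProbabilityMeasure W] (θ : Θ) (b : ℝ≥0∞) {t : ℕ → ℕ} (ht : Monotone t) (m : ℕ) :
    M.P (t 0) θ ({ω | (t 0 : ℕ∞) < M.wsrTime W a ω} ∩
        ⋂ j ∈ Finset.range m, M.lowBlock W b (t j) (t (j + 1))) =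
      M.P (t 0) θ {ω | (t 0 : ℕ∞) < M.wsrTime W a ω} *
        ∏ j ∈ Finset.range m, M.P (t 0) θ (M.lowBlock W b (t j) (t (j + 1))) := by
  induction m with
  | zero => simp
  | succ m ih =>
    have h0 : ∀ j, t 0 ≤ t j := fun j => ht (Nat.zero_le j)
    have hs : ({ω | (t 0 : ℕ∞) < M.wsrTime W a ω} ∩
        ⋂ j ∈ Finset.range (m + 1), M.lowBlock W b (t j) (t (j + 1))) =
        ({ω | (t 0 : ℕ∞) < M.wsrTime W a ω} ∩
        ⋂ j ∈ Finset.range m, M.lowBlock W b (t j) (t (j + 1))) ∩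
          M.lowBlock W b (t m) (t (m + 1)) := by
      rw [Finset.range_add_one, Finset.set_biInter_insert, inter_assoc,
        inter_comm (M.lowBlock W b (t m) (t (m + 1)))]
    rw [hs, P_inter_eq_mul hM hindep θ (h0 m) (ht m.le_succ) ?_ ?_ (measurableSet_lowBlock b _ _)
      (measurableSet_lowBlock_augmentedSpace hM θ b _ _), ih, Finset.prod_range_succ, mul_assoc,
      P_lowBlock hM hindep θ (h0 m) (ht m.le_succ)]
    · refine (M.obsFiltration.mono (h0 m) _ (measurableSet_lt_wsrTime _)).inter
        (Finset.measurableSet_biInter _ fun j hj => ?_)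
      exact M.obsFiltration.mono (ht (Finset.mem_range.1 hj)) _ (measurableSet_lowBlock b _ _)
    · refine MeasurableSet.inter (augmentedSpace_mono (incrSpace_mono le_rfl (h0 m)) _ _
        (measurableSet_lt_wsrTime_augmentedSpace hM θ _))
        (Finset.measurableSet_biInter _ fun j hj => ?_)
      exact augmentedSpace_mono (incrSpace_mono (Nat.zero_le _) (ht (Finset.mem_range.1 hj))) _ _
        (measurableSet_lowBlock_augmentedSpace hM θ b _ _)

/-- The weighted likelihood ratio of `[s, e)` is one of the nonnegative terms of `R_e^W`. -/
lemma mem_lowBlock_of_lt_wsrTime {s e : ℕ} (h : s < e) {ω : Ω}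
    (hω : (e : ℕ∞) < M.wsrTime W a ω) :
    ω ∈ M.lowBlock W (ENNReal.ofReal (Real.exp a)) s e := by
  rw [lt_wsrTime_iff] at hω
  refine lt_of_le_of_lt ?_ (hω e (Finset.mem_Icc.2 ⟨by omega, le_rfl⟩))
  exact Finset.single_le_sum (f := fun k => M.weightedLR W k e ω) (fun _ _ => zero_le)
    (Finset.mem_range.2 h)

/-- The end points of the blocks `[ν, ν + K)`, `[ν + K, ν + 2 K)`, `[ν + 2 K, ν + 4 K)`, …. -/
def dyadicTime (ν K : ℕ) : ℕ → ℕ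
  | 0 => ν
  | j + 1 => ν + 2 ^ j * K

lemma dyadicTime_strictMono (ν : ℕ) {K : ℕ} (hK : 0 < K) : StrictMono (dyadicTime ν K) := by
  refine strictMono_nat_of_lt_succ fun j => ?_
  cases j with
  | zero => simp [dyadicTime, hK]
  | succ j =>
    simp only [dyadicTime, pow_succ]
    have : 0 < 2 ^ j * K := by positivity
    nlinarith

lemma P_lt_wsrTime_le (hM : M.CommonSupport) (hindep : M.IndepIncrements)
    [IsProbabilityMeasure W] (θ : Θ) {ν K : ℕ} (hK : 0 < K) {η : ℝ≥0∞}
    (h : ∀ j, M.P ν θ (M.lowBlock W (ENNReal.ofReal (Real.exp a)) (dyadicTime ν K j)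
      (dyadicTime ν K (j + 1))) ≤ η) (m : ℕ) :
    M.P ν θ ({ω | (ν : ℕ∞) < M.wsrTime W a ω} ∩
      {ω | (dyadicTime ν K m : ℕ∞) < M.wsrTime W a ω}) ≤
      M.P ν θ {ω | (ν : ℕ∞) < M.wsrTime W a ω} * η ^ m := by
  have ht := dyadicTime_strictMono ν hK
  have key := P_lt_wsrTime_inter_lowBlock (W := W) (a := a) hM hindep θ
    (ENNReal.ofReal (Real.exp a)) ht.monotone m
  have e0 : dyadicTime ν K 0 = ν := rfl
  rw [e0] at key
  calc _ ≤ M.P ν θ ({ω | (ν : ℕ∞) < M.wsrTime W a ω} ∩ ⋂ j ∈ Finset.range m,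
          M.lowBlock W (ENNReal.ofReal (Real.exp a)) (dyadicTime ν K j)
            (dyadicTime ν K (j + 1))) := by
        refine measure_mono fun ω hω => ⟨hω.1, mem_iInter₂.2 fun j hj => ?_⟩
        refine mem_lowBlock_of_lt_wsrTime (ht j.lt_succ_self) (lt_of_le_of_lt ?_ hω.2)
        exact_mod_cast ht.monotone (Finset.mem_range.1 hj)
    _ ≤ _ := by
        rw [key]
        gcongr
        exact (Finset.prod_le_pow_card _ _ _ fun j _ => h j).trans (by simp)

/-- One term suffices: for the least `m` with `T - ν ≤ 2^m K`, minimality gives `T > t_m`. For `T =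
∞` infinitely many terms are at least `1`. -/
lemma sub_rpow_le_tsum {r : ℝ} (hr : 0 < r) {ν K : ℕ} (hK : 0 < K) {T : ℕ∞} (hT : (ν : ℕ∞) < T) :
    (((T - (ν : ℕ∞) : ℕ∞) : ℝ≥0∞)) ^ r ≤ (K : ℝ≥0∞) ^ r * ∑' m : ℕ, ((2 : ℝ≥0∞) ^ r) ^ m *
      (if (dyadicTime ν K m : ℕ∞) < T then 1 else 0) := by
  have h2 : (1 : ℝ≥0∞) ≤ 2 ^ r := ENNReal.one_le_rpow one_le_two hr
  have hK' : (K : ℝ≥0∞) ^ r ≠ 0 := by simp [ENNReal.rpow_eq_zero_iff, hK.ne']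
  induction T using ENat.recTopCoe with
  | top =>
    have : ∑' m : ℕ, ((2 : ℝ≥0∞) ^ r) ^ m *
        (if (dyadicTime ν K m : ℕ∞) < ⊤ then 1 else 0) = ∞ := by
      rw [eq_top_iff, ← ENNReal.tsum_const_eq_top_of_ne_zero (α := ℕ) one_ne_zero]
      refine ENNReal.tsum_le_tsum fun m => ?_
      simpa using one_le_pow₀ h2
    rw [this, ENNReal.mul_top hK']
    exact le_top
  | coe n =>
    have hn : ν < n := by exact_mod_cast hT
    have hex : ∃ m : ℕ, n - ν ≤ 2 ^ m * K :=
      ⟨n, (Nat.sub_le _ _).trans (Nat.lt_two_pow_self.le.trans (Nat.le_mul_of_pos_right _ hK))⟩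
    classical
    have hlt : dyadicTime ν K (Nat.find hex) < n := by
      cases hm : Nat.find hex with
      | zero => exact hn
      | succ m =>
        have := Nat.find_min hex (m := m) (by omega)
        simp only [dyadicTime]
        omega
    have hle : ((n - ν : ℕ) : ℝ≥0∞) ^ r ≤
        (K : ℝ≥0∞) ^ r * ((2 : ℝ≥0∞) ^ r) ^ Nat.find hex := by
      have h1 : ((n - ν : ℕ) : ℝ≥0∞) ≤ K * 2 ^ Nat.find hex := by
        have := Nat.find_spec hex
        rw [mul_comm] at this
        exact_mod_cast this
      refine (ENNReal.rpow_le_rpow h1 hr.le).trans (le_of_eq ?_)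
      rw [ENNReal.mul_rpow_of_nonneg _ _ hr.le, ← ENNReal.rpow_natCast, ← ENNReal.rpow_natCast,
        ← ENNReal.rpow_mul, ← ENNReal.rpow_mul, mul_comm r]
    have e : (((n : ℕ∞) - (ν : ℕ∞) : ℕ∞) : ℝ≥0∞) = ((n - ν : ℕ) : ℝ≥0∞) := by
      rw [← ENat.natCast_sub]; rfl
    rw [e]
    refine hle.trans ?_
    gcongr
    refine le_trans (le_of_eq ?_) (ENNReal.le_tsum (Nat.find hex))
    rw [if_pos (by exact_mod_cast hlt), mul_one]

/-- If in every dyadic block after `ν` the weighted likelihood ratio reaches the threshold with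
probability at least `1 - η`, then the risk of the weighted Shiryaev--Roberts procedure is at
most `K ^ r / (1 - 2 ^ r * η)`. -/
lemma risk_wsrTime_le (hM : M.CommonSupport) (hindep : M.IndepIncrements)
    [IsProbabilityMeasure W] {r : ℝ} (hr : 0 < r) (θ : Θ) {ν K : ℕ} (hK : 0 < K) {η : ℝ≥0∞}
    (h : ∀ j, M.P ν θ (M.lowBlock W (ENNReal.ofReal (Real.exp a)) (dyadicTime ν K j)
      (dyadicTime ν K (j + 1))) ≤ η) :
    M.risk r ν θ (M.wsrTime W a) ≤ (K : ℝ≥0∞) ^ r * (1 - 2 ^ r * η)⁻¹ := by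
  have hm : ∀ n : ℕ, MeasurableSet {ω | (n : ℕ∞) < M.wsrTime W a ω} := fun n =>
    M.obsFiltration.le n _ (measurableSet_lt_wsrTime n)
  set S := {ω | (ν : ℕ∞) < M.wsrTime W a ω} with hS
  calc M.risk r ν θ (M.wsrTime W a)
      ≤ ∫⁻ ω, (K : ℝ≥0∞) ^ r * ∑' m : ℕ, ((2 : ℝ≥0∞) ^ r) ^ m *
          {ω | (dyadicTime ν K m : ℕ∞) < M.wsrTime W a ω}.indicator 1 ω ∂((M.P ν θ)[|S]) := by
        refine lintegral_mono_ae ?_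
        filter_upwards [ae_cond_mem (hm ν)] with ω hω
        refine (sub_rpow_le_tsum hr hK hω).trans (le_of_eq ?_)
        simp [indicator_apply]
    _ = (K : ℝ≥0∞) ^ r * ∑' m : ℕ, ((2 : ℝ≥0∞) ^ r) ^ m *
          (M.P ν θ)[{ω | (dyadicTime ν K m : ℕ∞) < M.wsrTime W a ω} | S] := by
        have hmi : ∀ m : ℕ, Measurable ({ω | (dyadicTime ν K m : ℕ∞) <
            M.wsrTime W a ω}.indicator (1 : Ω → ℝ≥0∞)) := fun m =>
          measurable_const.indicator (hm _)
        rw [lintegral_const_mul _ (Measurable.tsum fun m => (hmi m).const_mul _),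
          lintegral_tsum fun m => ((hmi m).const_mul _).aemeasurable]
        congr 2
        ext m
        rw [lintegral_const_mul _ (hmi m), lintegral_indicator_one (hm _)]
    _ ≤ (K : ℝ≥0∞) ^ r * ∑' m : ℕ, (2 ^ r * η) ^ m := by
        gcongr with m
        rw [mul_pow]
        gcongr
        rw [cond_apply (hm ν)]
        refine (mul_le_mul_right (P_lt_wsrTime_le hM hindep θ hK h m) _).trans ?_
        -- The probability of `{T > ν}` cancels against the normalisation of the conditional
        -- measure.
        rw [← mul_assoc]
        exact mul_le_of_le_one_left (zero_le) (ENNReal.inv_mul_le_one _)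
    _ = _ := by rw [ENNReal.tsum_geometric]

end Blocks

end ChangePointModel

/-! ### Jensen's inequality and bounds for the weighted likelihood ratio. -/

/-- Jensen's inequality for the exponential function, without integrability of `exp ∘ g`. -/
lemma ofReal_exp_integral_le_lintegral {α : Type*} [MeasurableSpace α] {μ : Measure α}
    [IsProbabilityMeasure μ] {g : α → ℝ} (hg : Integrable g μ) :
    ENNReal.ofReal (Real.exp (∫ x, g x ∂μ)) ≤ ∫⁻ x, ENNReal.ofReal (Real.exp (g x)) ∂μ := by
  set m := ∫ x, g x ∂μ with hm
  -- The tangent line of `exp` at the mean `m` lies below `exp` and has integral `e^m`.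
  have h1 : ∫ x, Real.exp m * (1 + (g x - m)) ∂μ = Real.exp m := by
    have h2 : Integrable (fun x => g x - m) μ := hg.sub (integrable_const _)
    rw [integral_const_mul, integral_add (integrable_const _) h2,
      integral_sub hg (integrable_const _)]
    simp [← hm]
  calc ENNReal.ofReal (Real.exp m)
      = ENNReal.ofReal (∫ x, Real.exp m * (1 + (g x - m)) ∂μ) := by rw [h1]
    _ ≤ ∫⁻ x, ENNReal.ofReal (Real.exp m * (1 + (g x - m))) ∂μ := by
        have hF : Integrable (fun x => Real.exp m * (1 + (g x - m))) μ :=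
          ((integrable_const 1).add (hg.sub (integrable_const m))).const_mul _
        rw [integral_eq_lintegral_pos_part_sub_lintegral_neg_part hF]
        exact (ENNReal.ofReal_le_ofReal (sub_le_self _ ENNReal.toReal_nonneg)).trans
          ENNReal.ofReal_toReal_le
    _ ≤ ∫⁻ x, ENNReal.ofReal (Real.exp (g x)) ∂μ := by
        refine lintegral_mono fun x => ENNReal.ofReal_le_ofReal ?_
        have : Real.exp (g x) = Real.exp m * Real.exp (g x - m) := by
          rw [← Real.exp_add]; ring_nf
        rw [this]
        gcongr
        linarith [Real.add_one_le_exp (g x - m)]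

lemma eventually_ofReal_exp_neg_le {ε : ℝ} (hε : 0 < ε) {x : ℝ≥0∞} (hx : 0 < x) :
    ∀ᶠ n : ℕ in atTop, ENNReal.ofReal (Real.exp (-(ε * n))) ≤ x := by
  have h1 : Tendsto (fun n : ℕ => Real.exp (-(ε * n))) atTop (𝓝 0) :=
    Real.tendsto_exp_neg_atTop_nhds_zero.comp
      (tendsto_natCast_atTop_atTop.const_mul_atTop hε)
  have h2 := ENNReal.tendsto_ofReal h1
  rw [ENNReal.ofReal_zero] at h2
  exact (h2.eventually_lt_const hx).mono fun n hn => hn.le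

namespace ChangePointModel

section LikelihoodRatioBounds

variable {Ω 𝓧 Θ : Type*} [MeasurableSpace Ω] [MeasurableSpace 𝓧] [MeasurableSpace Θ]
  {M : ChangePointModel Ω 𝓧 Θ} {W : Measure Θ} {I : Θ → ℝ}

lemma lr_eq_ofReal_exp_llr {ω : Ω} (hω : ∀ i u, 0 < M.ratio i u ω) (k n : ℕ) (u : Θ) :
    M.lr k n u ω = ENNReal.ofReal (Real.exp (M.llr k n u ω)) := by
  rw [llr, Real.exp_sum, ENNReal.ofReal_prod_of_nonneg fun i _ => (Real.exp_pos _).le, lr]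
  refine Finset.prod_congr rfl fun i _ => ?_
  rw [llrIncr, Real.exp_log (by exact_mod_cast hω i u), ENNReal.ofReal_coe_nnreal]

lemma mul_exp_integral_llr_le_weightedLR [IsProbabilityMeasure W] {B : Set Θ} (hB : 0 < W B)
    {ω : Ω} (hω : ∀ i u, 0 < M.ratio i u ω) {k n : ℕ}
    (hint : Integrable (fun u => M.llr k n u ω) (W[|B])) :
    W B * ENNReal.ofReal (Real.exp (∫ u, M.llr k n u ω ∂(W[|B]))) ≤ M.weightedLR W k n ω := by
  have : IsProbabilityMeasure (W[|B]) := cond_isProbabilityMeasure hB.ne'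
  calc _ ≤ W B * ∫⁻ u, ENNReal.ofReal (Real.exp (M.llr k n u ω)) ∂(W[|B]) := by
        gcongr
        exact ofReal_exp_integral_le_lintegral hint
    _ = ∫⁻ u in B, M.lr k n u ω ∂W := by
        rw [ProbabilityTheory.cond, lintegral_smul_measure, smul_eq_mul, ← mul_assoc,
          ENNReal.mul_inv_cancel hB.ne' (measure_ne_top _ _), one_mul]
        simp only [lr_eq_ofReal_exp_llr hω]
    _ ≤ M.weightedLR W k n ω := setLIntegral_le_lintegral _ _

/-- Under `Pinf` the weighted likelihood ratio has mean one, so Markov's inequality gives `b⁻¹`; the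
change of measure costs the factor `C`. -/
lemma P_weightedLR_ge_le (hM : M.CommonSupport) [IsProbabilityMeasure W] (ν n : ℕ) (θ : Θ)
    (C b : ℝ≥0∞) :
    M.P ν θ ({ω | b ≤ M.weightedLR W ν n ω} ∩ {ω | M.lr ν n θ ω ≤ C}) ≤ C * b⁻¹ := by
  refine (P_inter_le hM ν θ n
    (M.measurable_weightedLR_obsFiltration W ν n measurableSet_Ici) C).trans ?_
  gcongr
  have h1 := mul_meas_ge_le_lintegral (μ := M.Pinf) (M.measurable_weightedLR W ν n) b
  have h2 := setLIntegral_weightedLR hM (W := W) ν n (A := univ) MeasurableSet.univ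
  simp only [Measure.restrict_univ, measure_univ, lintegral_one] at h2
  rw [h2] at h1
  rw [ENNReal.le_inv_iff_mul_le, mul_comm]
  exact h1

lemma RightTail.tendsto (hright : M.RightTail I) (ν : ℕ) (θ : Θ) {ε : ℝ} (hε : 0 < ε) :
    Tendsto (fun n : ℕ => M.P ν θ {ω | (1 + ε) * I θ * n ≤ M.llr ν (ν + n) θ ω})
      atTop (𝓝 0) := by
  refine tendsto_of_tendsto_of_tendsto_of_le_of_le' tendsto_const_nhds (hright ν θ ε hε)
    (Eventually.of_forall fun _ => zero_le) ?_
  filter_upwards [eventually_gt_atTop 0] with n hn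
  refine measure_mono fun ω hω => ⟨n, Finset.mem_Icc.2 ⟨hn, le_rfl⟩, ?_⟩
  exact (le_div_iff₀ (by exact_mod_cast hn)).2 hω

/-- The bound for the risk in terms of the probabilities of low blocks. -/
lemma risk_wsrTime_le_of_lowBlock (hM : M.CommonSupport) (hindep : M.IndepIncrements)
    [IsProbabilityMeasure W] {r : ℝ} (hr : 0 < r) (θ : Θ) {ν K : ℕ} (hK : 0 < K) {η : ℝ≥0∞}
    {a c : ℝ} (hc : 0 ≤ c) (ha : a ≤ c * K)
    (h1 : M.P ν θ (M.lowBlock W (ENNReal.ofReal (Real.exp (c * K))) ν (ν + K)) ≤ η)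
    (h2 : ∀ n ≥ K, M.P ν θ
      (M.lowBlock W (ENNReal.ofReal (Real.exp (c * n))) (ν + n) (ν + 2 * n)) ≤ η) :
    M.risk r ν θ (M.wsrTime W a) ≤ (K : ℝ≥0∞) ^ r * (1 - 2 ^ r * η)⁻¹ := by
  -- Since `a ≤ c K ≤ c n`, a block of length `n ≥ K` that grows at rate `c` crosses the threshold.
  have hmono : ∀ n ≥ K, ∀ s e, M.lowBlock W (ENNReal.ofReal (Real.exp a)) s e ⊆
      M.lowBlock W (ENNReal.ofReal (Real.exp (c * n))) s e := fun n hn s e ω hω =>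
    lt_of_lt_of_le hω (ENNReal.ofReal_le_ofReal (Real.exp_le_exp.2 (ha.trans (by gcongr))))
  refine risk_wsrTime_le hM hindep hr θ hK fun j => ?_
  cases j with
  | zero =>
    have e : dyadicTime ν K (0 + 1) = ν + K := by simp [dyadicTime]
    rw [e]
    exact (measure_mono (hmono K le_rfl _ _)).trans h1
  | succ j =>
    have hn : K ≤ 2 ^ j * K := Nat.le_mul_of_pos_left _ (by positivity)
    have e : dyadicTime ν K (j + 1 + 1) = ν + 2 * (2 ^ j * K) := by
      simp only [dyadicTime, pow_succ]; ring
    rw [e]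
    exact (measure_mono (hmono _ hn _ _)).trans (h2 _ hn)

end LikelihoodRatioBounds

/-! ### Low blocks are unlikely. -/

section LowBlocks

variable {Ω 𝓧 Θ : Type*} [MeasurableSpace Ω] [MeasurableSpace 𝓧] [MetricSpace Θ]
  [MeasurableSpace Θ] {M : ChangePointModel Ω 𝓧 Θ} {W : Measure Θ} {I : Θ → ℝ}

/-- An undefined integral is read as `0`, which is below `c > 0`; hence `ε ≤ I / 2` in the
applications. -/
lemma integrable_of_notMem_lowEvent {θ : Θ} {δ c : ℝ} (hc : 0 < c) {ℓ n : ℕ} {ω : Ω}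
    (h : ω ∉ M.lowEvent W θ δ c ℓ n) :
    Integrable (fun u => M.llr ℓ (ℓ + n) u ω) (W[|Metric.ball θ δ]) := by
  by_contra hc'
  refine h ?_
  rw [lowEvent, mem_ofPred_eq, integral_undef hc', zero_div]
  exact hc

lemma mul_le_integral_of_notMem_lowEvent {θ : Θ} {δ c : ℝ} {ℓ n : ℕ} (hn : 0 < n) {ω : Ω}
    (h : ω ∉ M.lowEvent W θ δ c ℓ n) :
    c * n ≤ ∫ u, M.llr ℓ (ℓ + n) u ω ∂(W[|Metric.ball θ δ]) := by
  rw [lowEvent, mem_ofPred_eq, not_lt] at h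
  exact (le_div_iff₀ (by exact_mod_cast hn)).1 h

lemma P_lowBlock_le_P_lowEvent (hM : M.CommonSupport) [IsProbabilityMeasure W] {ν ℓ n : ℕ}
    (hn : 0 < n) {θ : Θ} {δ c : ℝ} (hc : 0 < c) (hB : 0 < W (Metric.ball θ δ)) {b : ℝ≥0∞}
    (hb : b ≤ W (Metric.ball θ δ) * ENNReal.ofReal (Real.exp (c * n))) :
    M.P ν θ (M.lowBlock W b ℓ (ℓ + n)) ≤ M.P ν θ (M.lowEvent W θ δ c ℓ n) := by
  refine measure_mono_ae ?_
  filter_upwards [P_ae_ratio_pos hM ν θ] with ω hω hlow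
  by_contra h
  refine absurd hlow (not_lt.2 (hb.trans ?_))
  refine le_trans ?_ (mul_exp_integral_llr_le_weightedLR hB hω (integrable_of_notMem_lowEvent hc h))
  gcongr
  exact mul_le_integral_of_notMem_lowEvent hn h

/-- If the averages of the log-likelihood ratio over `[ν, ν + n)` and `[ν, ν + 2 n)` are not too
small and the former is not too large, then the block `[ν + n, ν + 2 n)` is not low. -/
lemma P_lowBlock_second_le (hM : M.CommonSupport) [IsProbabilityMeasure W] {ν n : ℕ}
    (hn : 0 < n) {θ : Θ} {δ c C : ℝ} (hc : 0 < c) (hB : 0 < W (Metric.ball θ δ)) {b b' : ℝ≥0∞}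
    (hb : b ≤ W (Metric.ball θ δ) * ENNReal.ofReal (Real.exp ((2 * c - C) * n)))
    (hb' : b' ≤ W (Metric.ball θ δ) * ENNReal.ofReal (Real.exp (C * n))) :
    M.P ν θ (M.lowBlock W b (ν + n) (ν + 2 * n)) ≤
      M.P ν θ (M.lowEvent W θ δ c ν n) + M.P ν θ (M.lowEvent W θ δ c ν (2 * n)) +
        M.P ν θ {ω | b' ≤ M.weightedLR W ν (ν + n) ω} := by
  refine le_trans (measure_mono_ae ?_) ((measure_union_le _ _).trans
    (add_le_add_left (measure_union_le _ _) _))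
  filter_upwards [P_ae_ratio_pos hM ν θ] with ω hω hlow
  by_contra h
  obtain ⟨h12, h3⟩ := not_or.1 h
  obtain ⟨h1, h2⟩ := not_or.1 h12
  replace h3 : M.weightedLR W ν (ν + n) ω < b' := not_le.1 h3
  have i1 := integrable_of_notMem_lowEvent hc h1
  have i2 := integrable_of_notMem_lowEvent hc h2
  -- Jensen read backwards: an upper bound for the weighted likelihood ratio bounds the average of
  -- its logarithm.
  have m1 : ∫ u, M.llr ν (ν + n) u ω ∂(W[|Metric.ball θ δ]) ≤ C * n := by
    have := (mul_exp_integral_llr_le_weightedLR hB hω i1).trans (h3.le.trans hb')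
    rw [ENNReal.mul_le_mul_iff_right hB.ne' (measure_ne_top _ _),
      ENNReal.ofReal_le_ofReal_iff (Real.exp_pos _).le, Real.exp_le_exp] at this
    exact this
  have m2 := mul_le_integral_of_notMem_lowEvent (by omega) h2
  have e : (fun u => M.llr (ν + n) (ν + 2 * n) u ω) =
      fun u => M.llr ν (ν + 2 * n) u ω - M.llr ν (ν + n) u ω := by
    ext u
    rw [eq_sub_iff_add_eq', llr, llr, llr, Finset.sum_Ico_consecutive _ (by omega) (by omega)]
  have i3 : Integrable (fun u => M.llr (ν + n) (ν + 2 * n) u ω) (W[|Metric.ball θ δ]) := by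
    rw [e]; exact i2.sub i1
  refine absurd hlow (not_lt.2 (hb.trans ?_))
  refine le_trans ?_ (mul_exp_integral_llr_le_weightedLR hB hω i3)
  gcongr
  rw [e, integral_sub i2 i1]
  push_cast at m2
  linarith

/-- A loss of `ε` in the exponential rate absorbs the fixed mass `W(Γ_δ)` once `n` is large. -/
lemma ofReal_exp_le_mul {n : ℕ} {ε x y : ℝ} (h : x + ε ≤ y) {w : ℝ≥0∞}
    (hw : ENNReal.ofReal (Real.exp (-(ε * n))) ≤ w) :
    ENNReal.ofReal (Real.exp (x * n)) ≤ w * ENNReal.ofReal (Real.exp (y * n)) := by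
  refine le_trans ?_ (mul_le_mul_left hw _)
  rw [← ENNReal.ofReal_mul (Real.exp_pos _).le, ← Real.exp_add]
  refine ENNReal.ofReal_le_ofReal (Real.exp_le_exp.2 ?_)
  have : (0 : ℝ) ≤ n := Nat.cast_nonneg n
  nlinarith

lemma LeftTail.exists_eventually_lt (hleft : M.LeftTail W I) (ν : ℕ) (θ : Θ) {ε : ℝ}
    (hε : 0 < ε) {η : ℝ≥0∞} (hη : 0 < η) : ∃ δ > 0, ∀ᶠ n : ℕ in atTop,
      M.P ν θ (M.lowEvent W θ δ (I θ - ε) ν n) < η := by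
  have h1 := (hleft ν θ ε hε ν le_rfl).eventually_lt_const hη
  obtain ⟨δ, h2, hδ⟩ := (h1.and self_mem_nhdsWithin).exists
  exact ⟨δ, hδ, eventually_lt_of_limsup_lt h2⟩

lemma eventually_P_lowBlock_first_le (hM : M.CommonSupport) [IsProbabilityMeasure W]
    (hW : ∀ (θ : Θ) (δ : ℝ), 0 < δ → 0 < W (Metric.ball θ δ)) (hleft : M.LeftTail W I)
    (ν : ℕ) {θ : Θ} (hI : 0 < I θ) {c : ℝ} (hc : c < I θ) {η : ℝ≥0∞} (hη : 0 < η) :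
    ∀ᶠ n : ℕ in atTop,
      M.P ν θ (M.lowBlock W (ENNReal.ofReal (Real.exp (c * n))) ν (ν + n)) ≤ η := by
  set ε := min ((I θ - c) / 2) (I θ / 2)
  have hε : 0 < ε := lt_min (by linarith) (by linarith)
  have hε1 : ε ≤ (I θ - c) / 2 := min_le_left _ _
  have hε2 : ε ≤ I θ / 2 := min_le_right _ _
  obtain ⟨δ, hδ, h⟩ := hleft.exists_eventually_lt ν θ hε hη
  filter_upwards [h, eventually_ofReal_exp_neg_le hε (hW θ δ hδ), eventually_gt_atTop 0]
    with n h1 h2 hn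
  refine (P_lowBlock_le_P_lowEvent hM hn (by linarith) (hW θ δ hδ) ?_).trans h1.le
  exact ofReal_exp_le_mul (by linarith) h2

lemma eventually_P_lowBlock_second_le (hM : M.CommonSupport) [IsProbabilityMeasure W]
    (hW : ∀ (θ : Θ) (δ : ℝ), 0 < δ → 0 < W (Metric.ball θ δ)) (hleft : M.LeftTail W I)
    (hright : M.RightTail I) (ν : ℕ) {θ : Θ} (hI : 0 < I θ) {c : ℝ} (hc : c < I θ) {η : ℝ≥0∞}
    (hη : 0 < η) : ∀ᶠ n : ℕ in atTop,
      M.P ν θ (M.lowBlock W (ENNReal.ofReal (Real.exp (c * n))) (ν + n) (ν + 2 * n)) ≤ η := by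
  -- The rate obtained is `2 (I - ε) - (I + 3 ε) = I - 5 ε`, and one more `ε` absorbs `W(Γ_δ)`. The
  -- four exceptional events get `η / 4` each.
  set ε := min ((I θ - c) / 6) (I θ / 2)
  have hε : 0 < ε := lt_min (by linarith) (by linarith)
  have hε1 : ε ≤ (I θ - c) / 6 := min_le_left _ _
  have hε2 : ε ≤ I θ / 2 := min_le_right _ _
  have hη4 : 0 < η / 4 := ENNReal.div_pos hη.ne' (by simp)
  obtain ⟨δ, hδ, h⟩ := hleft.exists_eventually_lt ν θ hε hη4
  have h' := (tendsto_id.const_mul_atTop' (r := 2) two_pos).eventually h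
  have hr := (hright.tendsto ν θ (div_pos hε hI)).eventually_lt_const hη4
  filter_upwards [h, h', hr, eventually_ofReal_exp_neg_le hε (hW θ δ hδ),
    eventually_ofReal_exp_neg_le hε hη4, eventually_gt_atTop 0] with n h1 h2 h3 h4 h5 hn
  have key := P_lowBlock_second_le hM (W := W) (ν := ν) hn (θ := θ) (δ := δ) (c := I θ - ε)
    (C := I θ + 3 * ε) (b := ENNReal.ofReal (Real.exp (c * n)))
    (b' := ENNReal.ofReal (Real.exp ((I θ + 2 * ε) * n))) (by linarith) (hW θ δ hδ)
    (ofReal_exp_le_mul (by linarith) h4) (ofReal_exp_le_mul (by linarith) h4)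
  have hup : M.P ν θ {ω | ENNReal.ofReal (Real.exp ((I θ + 2 * ε) * n)) ≤
      M.weightedLR W ν (ν + n) ω} ≤ η / 4 + η / 4 := by
    have hmk := P_weightedLR_ge_le hM (W := W) ν (ν + n) θ
      (ENNReal.ofReal (Real.exp ((I θ + ε) * n)))
      (ENNReal.ofReal (Real.exp ((I θ + 2 * ε) * n)))
    rw [← ENNReal.ofReal_inv_of_pos (Real.exp_pos _), ← Real.exp_neg,
      ← ENNReal.ofReal_mul (Real.exp_pos _).le, ← Real.exp_add] at hmk
    have e : (I θ + ε) * n + -((I θ + 2 * ε) * n) = -(ε * n) := by ring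
    rw [e] at hmk
    refine le_trans (measure_mono_ae ?_) ((measure_union_le _ _).trans
      (add_le_add h3.le (hmk.trans h5)))
    filter_upwards [P_ae_ratio_pos hM ν θ] with ω hω hge
    by_cases hz : (1 + ε / I θ) * I θ * n ≤ M.llr ν (ν + n) θ ω
    · exact Or.inl hz
    · refine Or.inr ⟨hge, ?_⟩
      rw [mem_ofPred_eq, lr_eq_ofReal_exp_llr hω]
      refine ENNReal.ofReal_le_ofReal (Real.exp_le_exp.2 ?_)
      have : (1 + ε / I θ) * I θ = I θ + ε := by field_simp
      rw [this] at hz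
      exact (not_le.1 hz).le
  calc _ ≤ η / 4 + η / 4 + (η / 4 + η / 4) :=
        key.trans (add_le_add (add_le_add h1.le h2.le) hup)
    _ = η := by
        rw [← two_mul, ← two_mul, ← mul_assoc, show (2 : ℝ≥0∞) * 2 = 4 by norm_num,
          ENNReal.mul_div_cancel (by simp) (by simp)]

lemma eventually_forall_P_lowBlock_le (hM : M.CommonSupport) (hindep : M.IndepIncrements)
    [IsProbabilityMeasure W]
    (hW : ∀ (θ : Θ) (δ : ℝ), 0 < δ → 0 < W (Metric.ball θ δ)) (hleft : M.UniformLeftTail W I)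
    {θ : Θ} (hI : 0 < I θ) {c : ℝ} (hc : c < I θ) {η : ℝ≥0∞} (hη : 0 < η) :
    ∀ᶠ n : ℕ in atTop, ∀ ν ℓ, ν ≤ ℓ →
      M.P ν θ (M.lowBlock W (ENNReal.ofReal (Real.exp (c * n))) ℓ (ℓ + n)) ≤ η := by
  set ε := min ((I θ - c) / 2) (I θ / 2)
  have hε : 0 < ε := lt_min (by linarith) (by linarith)
  have hε1 : ε ≤ (I θ - c) / 2 := min_le_left _ _
  have hε2 : ε ≤ I θ / 2 := min_le_right _ _
  have h1 := (hleft 0 θ ε hε).eventually_lt_const hη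
  obtain ⟨δ, h2, hδ⟩ := (h1.and self_mem_nhdsWithin).exists
  filter_upwards [eventually_lt_of_limsup_lt h2, eventually_ofReal_exp_neg_le hε (hW θ δ hδ),
    eventually_gt_atTop 0] with n h1 h2 hn ν ℓ hℓ
  -- Post-change blocks have the same law under `P ν θ` and `P 0 θ`, so the uniform condition at
  -- change point `0` serves all `ν`.
  rw [P_lowBlock hM hindep θ hℓ (Nat.le_add_right _ _)]
  refine (P_lowBlock_le_P_lowEvent hM hn (by linarith) (hW θ δ hδ)
    (ofReal_exp_le_mul (y := I θ - ε) (by linarith) h2)).trans (le_trans ?_ h1.le)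
  exact le_iSup₂ (f := fun (ℓ : ℕ) (_ : ℓ ≥ 0) => M.P 0 θ (M.lowEvent W θ δ (I θ - ε) ℓ n))
    ℓ (Nat.zero_le _)

end LowBlocks

end ChangePointModel

/-! ### First-order asymptotics and thresholds. -/

lemma tendsto_abs_log_nhdsGT_zero : Tendsto (fun α : ℝ => |Real.log α|) (𝓝[>] 0) atTop :=
  tendsto_abs_atBot_atTop.comp Real.tendsto_log_nhdsGT_zero

/-- A sandwich criterion for first-order asymptotics. -/
lemma firstOrder_of_bounds {R : ℝ → ℝ≥0∞} {I r : ℝ} (hI : 0 < I)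
    (hlow : ∀ t ∈ Ioo (0 : ℝ) 1, ∀ᶠ α in 𝓝[>] (0 : ℝ),
      ENNReal.ofReal (t * (t * (|Real.log α| / I)) ^ r) ≤ R α)
    (hup : ∀ t > 1, ∀ᶠ α in 𝓝[>] (0 : ℝ),
      R α ≤ ENNReal.ofReal (t * (t * (|Real.log α| / I)) ^ r)) :
    FirstOrder R I r := by
  have hcont : Tendsto (fun t : ℝ => ENNReal.ofReal (t * t ^ r)) (𝓝 1) (𝓝 1) := by
    have h : ContinuousAt (fun t : ℝ => t * t ^ r) 1 :=
      continuousAt_id.mul (Real.continuousAt_rpow_const 1 r (Or.inl one_ne_zero))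
    have := ENNReal.tendsto_ofReal h.tendsto
    simpa using this
  have hscale : ∀ t : ℝ, 0 < t → ∀ᶠ α in 𝓝[>] (0 : ℝ),
      ENNReal.ofReal (t * (t * (|Real.log α| / I)) ^ r) =
        ENNReal.ofReal (t * t ^ r) * ENNReal.ofReal ((|Real.log α| / I) ^ r) ∧
      0 < ENNReal.ofReal ((|Real.log α| / I) ^ r) := by
    intro t ht
    filter_upwards [tendsto_abs_log_nhdsGT_zero.eventually_gt_atTop 0] with α hα
    have hx : 0 < |Real.log α| / I := div_pos hα hI
    refine ⟨?_, ENNReal.ofReal_pos.2 (Real.rpow_pos_of_pos hx r)⟩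
    rw [Real.mul_rpow ht.le hx.le, ← mul_assoc, ENNReal.ofReal_mul (by positivity)]
  refine tendsto_order.2 ⟨fun c hc => ?_, fun c hc => ?_⟩
  · have h1 := (hcont.eventually_const_lt hc).filter_mono (nhdsWithin_le_nhds (s := Iio 1))
    obtain ⟨t, htc, ht⟩ := (h1.and (Ioo_mem_nhdsLT (zero_lt_one' ℝ))).exists
    filter_upwards [hlow t ht, hscale t ht.1] with α h2 h3
    refine htc.trans_le ?_
    rw [ENNReal.le_div_iff_mul_le (Or.inl h3.2.ne') (Or.inl ENNReal.ofReal_ne_top), ← h3.1]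
    exact h2
  · have h1 := (hcont.eventually_lt_const hc).filter_mono (nhdsWithin_le_nhds (s := Ioi 1))
    obtain ⟨t, htc, ht⟩ := (h1.and self_mem_nhdsWithin).exists
    filter_upwards [hup t ht, hscale t (zero_lt_one.trans ht)] with α h2 h3
    refine lt_of_le_of_lt ?_ htc
    rw [ENNReal.div_le_iff h3.2.ne' ENNReal.ofReal_ne_top, ← h3.1]
    exact h2

lemma tendsto_log_threshold {ϱ : ℝ → ℝ} (hϱ : ∀ α ∈ Ioo (0 : ℝ) 1, ϱ α ∈ Ioo (0 : ℝ) 1)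
    (hϱ0 : Tendsto ϱ (𝓝[>] 0) (𝓝 0))
    (hϱlog : Tendsto (fun α => |Real.log (ϱ α)| / |Real.log α|) (𝓝[>] 0) (𝓝 0)) :
    Tendsto (fun α => Real.log ((1 - ϱ α) / (ϱ α * α)) / |Real.log α|) (𝓝[>] 0) (𝓝 1) := by
  have h1 : Tendsto (fun α => Real.log (1 - ϱ α)) (𝓝[>] 0) (𝓝 0) := by
    have h : Tendsto (fun α => 1 - ϱ α) (𝓝[>] 0) (𝓝 1) := by
      simpa using hϱ0.const_sub 1
    simpa using h.log one_ne_zero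
  have h2 := (h1.div_atTop tendsto_abs_log_nhdsGT_zero).add (hϱlog.add_const 1)
  simp only [zero_add] at h2
  refine h2.congr' ?_
  filter_upwards [Ioo_mem_nhdsGT (zero_lt_one' ℝ)] with α hα
  obtain ⟨h0, h1⟩ := hϱ α hα
  have hl : Real.log α < 0 := Real.log_neg hα.1 hα.2
  have hl' : Real.log (ϱ α) < 0 := Real.log_neg h0 h1
  rw [Real.log_div (by linarith) (mul_pos h0 hα.1).ne', Real.log_mul h0.ne' hα.1.ne',
    abs_of_neg hl, abs_of_neg hl']
  have := hl.ne
  field_simp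
  ring

namespace ChangePointModel

/-! ### Lower bound over the class. -/

section LowerBound

variable {Ω 𝓧 Θ : Type*} [MeasurableSpace Ω] [MeasurableSpace 𝓧] [MeasurableSpace Θ]
  {M : ChangePointModel Ω 𝓧 Θ} {I : Θ → ℝ}

lemma measurableSet_lt_of_isStoppingTime {τ : Ω → ℕ∞} (hτ : IsStoppingTime M.obsFiltration τ)
    (n : ℕ) : MeasurableSet {ω | (n : ℕ∞) < τ ω} := by
  have := (M.obsFiltration.le n _ (hτ n)).compl
  convert this using 1
  ext ω
  exact (not_le (a := τ ω) (b := (n : ℕ∞))).symm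

lemma mul_P_lt_le_risk {τ : Ω → ℕ∞} (hτ : IsStoppingTime M.obsFiltration τ) {r : ℝ} (hr : 0 < r)
    (ν : ℕ) (θ : Θ) (L : ℕ) :
    (L : ℝ≥0∞) ^ r * M.P ν θ {ω | ((ν + L : ℕ) : ℕ∞) < τ ω} ≤ M.risk r ν θ τ := by
  have hm := measurableSet_lt_of_isStoppingTime hτ
  set S := {ω | (ν : ℕ∞) < τ ω} with hS
  set A := {ω | ((ν + L : ℕ) : ℕ∞) < τ ω} with hA
  have hAS : A ⊆ S := fun ω hω =>
    lt_of_le_of_lt (b := ((ν + L : ℕ) : ℕ∞)) (by exact_mod_cast Nat.le_add_right ν L) hω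
  -- Conditioning on an event containing `A` can only increase its probability.
  have h1 : M.P ν θ A ≤ (M.P ν θ)[A | S] := by
    rw [cond_apply (hm ν), inter_eq_right.2 hAS]
    exact le_mul_of_one_le_left zero_le (ENNReal.one_le_inv.2 prob_le_one)
  calc (L : ℝ≥0∞) ^ r * M.P ν θ A ≤ (L : ℝ≥0∞) ^ r * (M.P ν θ)[A | S] := by gcongr
    _ = ∫⁻ ω, A.indicator (fun _ => (L : ℝ≥0∞) ^ r) ω ∂((M.P ν θ)[|S]) :=
        (lintegral_indicator_const (hm _) _).symm
    _ ≤ M.risk r ν θ τ := by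
        refine lintegral_mono fun ω => indicator_le
          (g := fun ω => ((τ ω - (ν : ℕ∞) : ℕ∞) : ℝ≥0∞) ^ r) (fun ω hω => ?_) ω
        refine ENNReal.rpow_le_rpow ?_ hr.le
        have : ((L : ℕ) : ℕ∞) ≤ τ ω - (ν : ℕ∞) := by
          have h2 : ((ν + L : ℕ) : ℕ∞) ≤ τ ω := le_of_lt hω
          push_cast at h2
          exact (ENat.addLECancellable_natCast ν).le_tsub_of_add_le_left h2
        have h3 := ENat.toENNReal_mono this
        simpa using h3

lemma P_le_of_mem_bayesClass (hM : M.CommonSupport) {α ϱ : ℝ} (hϱ : ϱ ∈ Ioo (0 : ℝ) 1)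
    {τ : Ω → ℕ∞} (hτ : τ ∈ M.bayesClass α ϱ) (ν N : ℕ) (θ : Θ) (C : ℝ) :
    M.P ν θ {ω | τ ω ≤ (N : ℕ∞)} ≤ M.P ν θ {ω | C ≤ M.llr ν N θ ω} +
      ENNReal.ofReal (Real.exp C * (α / (1 - ϱ) ^ N)) := by
  have hq : 0 < (1 - ϱ) ^ N := pow_pos (by linarith [hϱ.2]) N
  have h1 : M.Pinf {ω | τ ω ≤ (N : ℕ∞)} ≤ ENNReal.ofReal (α / (1 - ϱ) ^ N) := by
    rw [ENNReal.ofReal_div_of_pos hq, ENNReal.le_div_iff_mul_le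
      (Or.inl (by simpa using hq)) (Or.inl ENNReal.ofReal_ne_top), mul_comm]
    exact Pinf_le_of_pfa_le hϱ hτ.2 N
  have h2 := P_inter_le hM ν θ N (hτ.1 N) (ENNReal.ofReal (Real.exp C))
  rw [ENNReal.ofReal_mul (Real.exp_pos _).le]
  refine le_trans (measure_mono_ae ?_) ((measure_union_le _ _).trans
    (add_le_add_right (h2.trans (mul_le_mul_right h1 _)) _))
  filter_upwards [P_ae_ratio_pos hM ν θ] with ω hω hle
  by_cases hC : C ≤ M.llr ν N θ ω
  · exact Or.inl hC
  · refine Or.inr ⟨hle, ?_⟩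
    rw [mem_ofPred_eq, lr_eq_ofReal_exp_llr hω]
    exact ENNReal.ofReal_le_ofReal (Real.exp_le_exp.2 (not_le.1 hC).le)

/-- With high probability no stopping time of the class raises an alarm within
`κ |log α| / I` observations after the change. -/
lemma eventually_P_le_of_mem_bayesClass (hM : M.CommonSupport) (hright : M.RightTail I)
    {ϱ : ℝ → ℝ} (hϱ : ∀ α ∈ Ioo (0 : ℝ) 1, ϱ α ∈ Ioo (0 : ℝ) 1)
    (hϱ0 : Tendsto ϱ (𝓝[>] 0) (𝓝 0)) (ν : ℕ) {θ : Θ} (hI : 0 < I θ) {κ : ℝ}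
    (hκ : κ ∈ Ioo (0 : ℝ) 1) {η : ℝ≥0∞} (hη : 0 < η) :
    ∀ᶠ α in 𝓝[>] (0 : ℝ), ∀ τ ∈ M.bayesClass α (ϱ α),
      M.P ν θ {ω | τ ω ≤ ((ν + ⌊κ * (|Real.log α| / I θ)⌋₊ : ℕ) : ℕ∞)} ≤ η := by
  obtain ⟨hκ0, hκ1⟩ := hκ
  have hη2 : 0 < η / 2 := ENNReal.div_pos hη.ne' (by simp)
  have hx : Tendsto (fun α => κ * (|Real.log α| / I θ)) (𝓝[>] 0) atTop :=
    (tendsto_abs_log_nhdsGT_zero.atTop_div_const hI).const_mul_atTop hκ0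
  -- Chosen so that `(1 + ε) κ = (1 + κ) / 2`. With `s` below, the exponent is at most `-(1 - κ)/2 +
  -- (1 - κ)/8 + (1 - κ)/8 = -(1 - κ)/4` times `|log α|`.
  set ε := (1 - κ) / (2 * κ) with hε
  have hε0 : 0 < ε := div_pos (by linarith) (by linarith)
  have h1 := ((hright.tendsto ν θ hε0).comp
    (tendsto_nat_floor_atTop.comp hx)).eventually_lt_const hη2
  set s := (1 - κ) * I θ / 8 with hs
  have hs0 : 0 < s := by have : 0 < 1 - κ := by linarith
                         positivity
  have h2 : ∀ᶠ α in 𝓝[>] (0 : ℝ), -s < Real.log (1 - ϱ α) := by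
    have h : Tendsto (fun α => 1 - ϱ α) (𝓝[>] 0) (𝓝 1) := by simpa using hϱ0.const_sub 1
    have h' := h.log one_ne_zero
    rw [Real.log_one] at h'
    exact h'.eventually_const_lt (by linarith)
  have h3 := tendsto_abs_log_nhdsGT_zero.eventually_ge_atTop (8 * (s * ν) / (1 - κ))
  have h4 : ∀ᶠ α in 𝓝[>] (0 : ℝ),
      ENNReal.ofReal (Real.exp (-((1 - κ) / 4 * |Real.log α|))) < η / 2 := by
    have h : Tendsto (fun α => Real.exp (-((1 - κ) / 4 * |Real.log α|))) (𝓝[>] 0) (𝓝 0) :=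
      Real.tendsto_exp_neg_atTop_nhds_zero.comp
        (tendsto_abs_log_nhdsGT_zero.const_mul_atTop (by linarith))
    have := ENNReal.tendsto_ofReal h
    rw [ENNReal.ofReal_zero] at this
    exact this.eventually_lt_const hη2
  filter_upwards [h1, h2, h3, h4, Ioo_mem_nhdsGT (zero_lt_one' ℝ)] with α h1 h2 h3 h4 hα τ hτ
  set L := ⌊κ * (|Real.log α| / I θ)⌋₊ with hL
  have hlog : Real.log α = -|Real.log α| := by rw [abs_of_neg (Real.log_neg hα.1 hα.2), neg_neg]
  set ℓ := |Real.log α|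
  have hℓ : 0 ≤ ℓ := abs_nonneg _
  have hLle : (L : ℝ) * I θ ≤ κ * ℓ := by
    have : (L : ℝ) ≤ κ * (ℓ / I θ) := Nat.floor_le (by positivity)
    calc (L : ℝ) * I θ ≤ κ * (ℓ / I θ) * I θ := by gcongr
      _ = κ * ℓ := by field_simp
  refine (P_le_of_mem_bayesClass hM (hϱ α hα) hτ ν (ν + L) θ ((1 + ε) * I θ * L)).trans ?_
  rw [← ENNReal.add_halves η]
  refine add_le_add h1.le (le_trans (ENNReal.ofReal_le_ofReal ?_) h4.le)
  have hq : 0 < 1 - ϱ α := by linarith [(hϱ α hα).2]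
  have e : Real.exp ((1 + ε) * I θ * L) * (α / (1 - ϱ α) ^ (ν + L)) =
      Real.exp ((1 + ε) * I θ * L - ℓ - (ν + L : ℕ) * Real.log (1 - ϱ α)) := by
    rw [Real.exp_sub, Real.exp_sub, Real.exp_nat_mul, Real.exp_log hq, ← neg_neg ℓ, ← hlog,
      Real.exp_neg, Real.exp_log hα.1]
    field_simp
  rw [e]
  refine Real.exp_le_exp.2 ?_
  have b1 : (1 + ε) * I θ * L ≤ (1 + κ) / 2 * ℓ := by
    have : (1 + ε) * κ = (1 + κ) / 2 := by rw [hε]; field_simp; ring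
    calc (1 + ε) * I θ * L = (1 + ε) * (L * I θ) := by ring
      _ ≤ (1 + ε) * (κ * ℓ) := by gcongr
      _ = (1 + κ) / 2 * ℓ := by rw [← this]; ring
  have b2 : -(((ν + L : ℕ) : ℝ) * Real.log (1 - ϱ α)) ≤ (ν + L : ℕ) * s := by
    rw [← mul_neg]
    gcongr
    linarith
  have b3 : s * ν ≤ (1 - κ) / 8 * ℓ := by
    rw [div_le_iff₀ (by linarith)] at h3
    linarith
  have b4 : (L : ℝ) * s ≤ (1 - κ) / 8 * ℓ := by
    have : (L : ℝ) * s = (1 - κ) / 8 * (L * I θ) := by rw [hs]; ring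
    rw [this]
    have : κ * ℓ ≤ ℓ := mul_le_of_le_one_left hℓ hκ1.le
    have h0 : 0 ≤ (1 - κ) / 8 := by linarith
    gcongr
    linarith
  push_cast at b2 ⊢
  nlinarith

/-- The asymptotic lower bound for the risk over the class `Δ(α)`. -/
lemma eventually_le_risk (hM : M.CommonSupport) (hright : M.RightTail I)
    {ϱ : ℝ → ℝ} (hϱ : ∀ α ∈ Ioo (0 : ℝ) 1, ϱ α ∈ Ioo (0 : ℝ) 1)
    (hϱ0 : Tendsto ϱ (𝓝[>] 0) (𝓝 0)) {r : ℝ} (hr : 0 < r) (ν : ℕ) {θ : Θ} (hI : 0 < I θ) {t : ℝ}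
    (ht : t ∈ Ioo (0 : ℝ) 1) :
    ∀ᶠ α in 𝓝[>] (0 : ℝ), ∀ τ ∈ M.bayesClass α (ϱ α),
      ENNReal.ofReal (t * (t * (|Real.log α| / I θ)) ^ r) ≤ M.risk r ν θ τ := by
  obtain ⟨ht0, ht1⟩ := ht
  -- Taking `κ` halfway between `t` and `1` leaves room for the floor: `κ x - 1 ≥ t x` once `x ≥ 2 /
  -- (1 - t)`.
  have h1 := eventually_P_le_of_mem_bayesClass hM hright hϱ hϱ0 ν hI (κ := (1 + t) / 2)
    ⟨by linarith, by linarith⟩ (η := ENNReal.ofReal (1 - t)) (by simpa using ht1)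
  have h2 := (tendsto_abs_log_nhdsGT_zero.atTop_div_const hI).eventually_ge_atTop (2 / (1 - t))
  filter_upwards [h1, h2] with α h1 h2 τ hτ
  set x := |Real.log α| / I θ
  set L := ⌊(1 + t) / 2 * x⌋₊
  have hx : 0 ≤ x := div_nonneg (abs_nonneg _) hI.le
  have hL : t * x ≤ L := by
    have hf := Nat.lt_floor_add_one ((1 + t) / 2 * x)
    rw [div_le_iff₀ (by linarith)] at h2
    change _ < (L : ℝ) + 1 at hf
    linarith
  refine le_trans ?_ (mul_P_lt_le_risk hτ.1 hr ν θ L)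
  have hP : ENNReal.ofReal t ≤ M.P ν θ {ω | ((ν + L : ℕ) : ℕ∞) < τ ω} := by
    have hc : {ω | ((ν + L : ℕ) : ℕ∞) < τ ω} = {ω | τ ω ≤ ((ν + L : ℕ) : ℕ∞)}ᶜ := by
      ext ω; exact (not_le (a := τ ω) (b := ((ν + L : ℕ) : ℕ∞))).symm
    have hm : MeasurableSet {ω | τ ω ≤ ((ν + L : ℕ) : ℕ∞)} :=
      M.obsFiltration.le _ _ (hτ.1 (ν + L))
    rw [hc, prob_compl_eq_one_sub hm]
    calc ENNReal.ofReal t = 1 - ENNReal.ofReal (1 - t) := by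
          rw [← ENNReal.ofReal_one, ← ENNReal.ofReal_sub _ (by linarith)]; ring_nf
      _ ≤ _ := tsub_le_tsub_left (h1 τ hτ) 1
  rw [ENNReal.ofReal_mul ht0.le, mul_comm]
  gcongr
  rw [← ENNReal.ofReal_rpow_of_nonneg (by positivity) hr.le]
  refine ENNReal.rpow_le_rpow ?_ hr.le
  rw [← ENNReal.ofReal_natCast]
  exact ENNReal.ofReal_le_ofReal hL

end LowerBound

/-! ### Upper bound for the weighted Shiryaev–Roberts procedure. -/

section UpperBound

variable {Ω 𝓧 Θ : Type*} [MeasurableSpace Ω] [MeasurableSpace 𝓧] [MeasurableSpace Θ]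
  {M : ChangePointModel Ω 𝓧 Θ} {W : Measure Θ} [IsProbabilityMeasure W] {I : Θ → ℝ}

/-- The asymptotic upper bound for the risk of the weighted Shiryaev--Roberts procedure, uniformly
over a set of change points. -/
lemma eventually_risk_wsrTime_le (hM : M.CommonSupport) (hindep : M.IndepIncrements) {θ : Θ}
    (hI : 0 < I θ) (S : Set ℕ)
    (hlow : ∀ c < I θ, ∀ η : ℝ≥0∞, 0 < η → ∀ᶠ n : ℕ in atTop, ∀ ν ∈ S,
      M.P ν θ (M.lowBlock W (ENNReal.ofReal (Real.exp (c * n))) ν (ν + n)) ≤ η ∧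
      M.P ν θ (M.lowBlock W (ENNReal.ofReal (Real.exp (c * n))) (ν + n) (ν + 2 * n)) ≤ η)
    {a : ℝ → ℝ} (ha : Tendsto (fun α => a α / |Real.log α|) (𝓝[>] 0) (𝓝 1)) {r : ℝ} (hr : 0 < r)
    {t : ℝ} (ht : 1 < t) :
    ∀ᶠ α in 𝓝[>] (0 : ℝ), ∀ ν ∈ S, M.risk r ν θ (M.wsrTime W (a α)) ≤
      ENNReal.ofReal (t * (t * (|Real.log α| / I θ)) ^ r) := by
  -- thresholds are reached within blocks of length about `s |log α| / I` at rate `c`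
  set s := (1 + t) / 2 with hs
  have hs1 : 1 < s := by linarith
  -- Then `c < I`, yet growth at rate `c` over `s |log α| / I` observations yields `(1 + s)/2 * |log
  -- α|`, eventually more than `a α`.
  set c := I θ * ((1 + s) / (2 * s)) with hc
  have hcI : c < I θ := mul_lt_of_lt_one_right hI ((div_lt_one (by linarith)).2 (by linarith))
  have hc0 : 0 < c := by positivity
  -- Solves `(1 - 2^r η)⁻¹ = t`.
  set η : ℝ≥0∞ := (1 - (ENNReal.ofReal t)⁻¹) / 2 ^ r with hη
  have h2r : (2 : ℝ≥0∞) ^ r ≠ ∞ := ENNReal.rpow_ne_top_of_nonneg hr.le (by simp)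
  have h2r0 : (2 : ℝ≥0∞) ^ r ≠ 0 := by simp [ENNReal.rpow_eq_zero_iff]
  have ht' : (ENNReal.ofReal t)⁻¹ < 1 := ENNReal.inv_lt_one.2 (by simpa using ht)
  have hη0 : 0 < η := ENNReal.div_pos (tsub_pos_of_lt ht').ne' h2r
  have hgeom : (1 - 2 ^ r * η)⁻¹ = ENNReal.ofReal t := by
    rw [hη, ENNReal.mul_div_cancel h2r0 h2r, ENNReal.sub_sub_cancel ENNReal.one_ne_top ht'.le,
      inv_inv]
  have hx := tendsto_abs_log_nhdsGT_zero.atTop_div_const hI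
  obtain ⟨N, hN⟩ := eventually_atTop.1 (hlow c hcI η hη0)
  have hK := (tendsto_nat_ceil_atTop.comp (hx.const_mul_atTop (zero_lt_one.trans hs1)))
    |>.eventually_ge_atTop (max N 1)
  filter_upwards [hK, hx.eventually_ge_atTop (1 / (t - s)),
    ha.eventually_lt_const (show 1 < (1 + s) / 2 by linarith),
    tendsto_abs_log_nhdsGT_zero.eventually_gt_atTop 0] with α hK hx ha hℓ ν hν
  set x := |Real.log α| / I θ with hxdef
  set K := ⌈s * x⌉₊
  change max N 1 ≤ K at hK
  have hx0 : 0 < x := div_pos hℓ hI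
  have hKx : s * x ≤ K := Nat.le_ceil _
  have haK : a α ≤ c * K := by
    rw [div_lt_iff₀ hℓ] at ha
    calc a α ≤ (1 + s) / 2 * |Real.log α| := ha.le
      _ = c * (s * x) := by rw [hc, hxdef]; field_simp
      _ ≤ c * K := by gcongr
  refine (risk_wsrTime_le_of_lowBlock hM hindep hr θ (by omega) hc0.le haK
    (hN K (by omega) ν hν).1 fun n hn => (hN n (by omega) ν hν).2).trans ?_
  rw [hgeom, mul_comm, ENNReal.ofReal_mul (by linarith)]
  gcongr
  rw [← ENNReal.ofReal_rpow_of_nonneg (by positivity) hr.le]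
  refine ENNReal.rpow_le_rpow ?_ hr.le
  rw [← ENNReal.ofReal_natCast]
  refine ENNReal.ofReal_le_ofReal ?_
  have : (K : ℝ) < s * x + 1 := Nat.ceil_lt_add_one (by positivity)
  rw [div_le_iff₀ (by linarith)] at hx
  linarith

end UpperBound

end ChangePointModel

/-! ### The theorem. -/

theorem mainTheorem7 {Ω 𝓧 Θ : Type*} [MeasurableSpace Ω] [MeasurableSpace 𝓧]
    [MetricSpace Θ] [MeasurableSpace Θ] [BorelSpace Θ]
    (M : ChangePointModel Ω 𝓧 Θ) (hM : M.CommonSupport)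
    (W : Measure Θ) [IsProbabilityMeasure W]
    (hW : ∀ (θ : Θ) (δ : ℝ), 0 < δ → 0 < W (Metric.ball θ δ))
    (I : Θ → ℝ) (hI : ∀ θ, 0 < I θ)
    (hindep : M.IndepIncrements) (hright : M.RightTail I) (hleft : M.LeftTail W I)
    (ϱ : ℝ → ℝ) (hϱ : ∀ α ∈ Ioo (0 : ℝ) 1, ϱ α ∈ Ioo (0 : ℝ) 1)
    (hϱ0 : Tendsto ϱ (𝓝[>] 0) (𝓝 0))
    (hϱlog : Tendsto (fun α => |Real.log (ϱ α)| / |Real.log α|) (𝓝[>] 0) (𝓝 0)) :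
    -- the threshold `log ((1 - ϱ_α) / (ϱ_α α))` is admissible
    ((∀ α ∈ Ioo (0 : ℝ) 1,
        M.wsrTime W (Real.log ((1 - ϱ α) / (ϱ α * α))) ∈ M.bayesClass α (ϱ α)) ∧
      AdmissibleThreshold M W ϱ fun α => Real.log ((1 - ϱ α) / (ϱ α * α))) ∧
    ∀ a : ℝ → ℝ, AdmissibleThreshold M W ϱ a → ∀ r : ℝ, 0 < r → ∀ θ : Θ,
      -- pointwise optimality
      (∀ ν : ℕ,
        FirstOrder (fun α => ⨅ τ ∈ M.bayesClass α (ϱ α), M.risk r ν θ τ) (I θ) r ∧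
        FirstOrder (fun α => M.risk r ν θ (M.wsrTime W (a α))) (I θ) r) ∧
      -- minimax optimality
      (M.UniformLeftTail W I → ∀ kstar : ℝ → ℕ, Tendsto kstar (𝓝[>] 0) atTop →
        Tendsto (fun α => α * ϱ α * (kstar α : ℝ)) (𝓝[>] 0) (𝓝 0) →
        FirstOrder (fun α => ⨅ τ ∈ M.bayesClass α (ϱ α), ⨆ ν ≤ kstar α, M.risk r ν θ τ)
          (I θ) r ∧
        FirstOrder (fun α => ⨆ ν ≤ kstar α, M.risk r ν θ (M.wsrTime W (a α))) (I θ) r) := by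
  refine ⟨⟨fun α hα => ChangePointModel.wsrTime_mem_bayesClass hM hα.1 (hϱ α hα), ?_,
    tendsto_log_threshold hϱ hϱ0 hϱlog⟩, fun a ha r hr θ => ?_⟩
  · filter_upwards [Ioo_mem_nhdsGT (zero_lt_one' ℝ)] with α hα
    exact ChangePointModel.pfa_wsrTime_le hM hα.1 (hϱ α hα)
  have hmem : ∀ᶠ α in 𝓝[>] (0 : ℝ), M.wsrTime W (a α) ∈ M.bayesClass α (ϱ α) :=
    ha.1.mono fun α h => ⟨ChangePointModel.isStoppingTime_wsrTime, h⟩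
  have hlow := fun ν t ht =>
    ChangePointModel.eventually_le_risk hM hright hϱ hϱ0 hr ν (θ := θ) (t := t) (hI θ) ht
  constructor
  · intro ν
    have hup := fun t ht => ChangePointModel.eventually_risk_wsrTime_le (t := t) hM hindep (hI θ)
      {ν} (fun c hc η hη => by
        filter_upwards [ChangePointModel.eventually_P_lowBlock_first_le hM hW hleft ν (hI θ) hc hη,
          ChangePointModel.eventually_P_lowBlock_second_le hM hW hleft hright ν (hI θ) hc hη]
          with n h1 h2 ν' hν'
        rw [mem_singleton_iff.1 hν']
        exact ⟨h1, h2⟩) ha.2 hr ht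
    refine ⟨firstOrder_of_bounds (hI θ) (fun t ht => ?_) (fun t ht => ?_),
      firstOrder_of_bounds (hI θ) (fun t ht => ?_) (fun t ht => ?_)⟩
    · exact (hlow ν t ht).mono fun α h => le_iInf₂ h
    · filter_upwards [hmem, hup t ht] with α h1 h2
      exact (iInf₂_le _ h1).trans (h2 ν rfl)
    · filter_upwards [hmem, hlow ν t ht] with α h1 h2
      exact h2 _ h1
    · exact (hup t ht).mono fun α h => h ν rfl
  · intro hunif kstar _ _
    have hup := fun t ht => ChangePointModel.eventually_risk_wsrTime_le (t := t) hM hindep (hI θ)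
      univ (fun c hc η hη => by
        filter_upwards [ChangePointModel.eventually_forall_P_lowBlock_le hM hindep hW hunif (hI θ)
          hc hη] with n h ν _
        refine ⟨h ν ν le_rfl, ?_⟩
        rw [two_mul, ← add_assoc]
        exact h ν (ν + n) (Nat.le_add_right _ _)) ha.2 hr ht
    -- The maximum dominates its term `ν = 0`, so the pointwise lower bound carries over; the upper
    -- bound holds for all `ν` simultaneously.
    have hzero : ∀ (k : ℕ) (τ : Ω → ℕ∞), M.risk r 0 θ τ ≤ ⨆ ν ≤ k, M.risk r ν θ τ :=
      fun k τ => le_iSup₂ (f := fun (ν : ℕ) (_ : ν ≤ k) => M.risk r ν θ τ) 0 (Nat.zero_le k)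
    refine ⟨firstOrder_of_bounds (hI θ) (fun t ht => ?_) (fun t ht => ?_),
      firstOrder_of_bounds (hI θ) (fun t ht => ?_) (fun t ht => ?_)⟩
    · exact (hlow 0 t ht).mono fun α h => le_iInf₂ fun τ hτ => (h τ hτ).trans (hzero _ τ)
    · filter_upwards [hmem, hup t ht] with α h1 h2
      exact (iInf₂_le _ h1).trans (iSup₂_le fun ν _ => h2 ν trivial)
    · filter_upwards [hmem, hlow 0 t ht] with α h1 h2
      exact (h2 _ h1).trans (hzero _ _)
    · exact (hup t ht).mono fun α h => iSup₂_le fun ν _ => h ν trivial
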